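/- Let $n\ge 3$ and let $U\subset\mathbb R^n$ be a non-empty connected open set with coordinates $x=(x^i)$. Let $\alpha=\sqrt{a_{ij}(x)y^iy^j}$ be a smooth Riemannian metric and $\beta=b_i(x)y^i$ a smooth 1-form on $U$; let $b^2=b^2(x)=a^{ij}b_ib_j=\|\beta_x\|_\alpha^2$, and let $b_{i|j}$ be the covariant derivative of $\beta$ with respect to $\alpha$. Let $\phi=\phi(t,s)$ be a $C^\infty$ function on an open set of $\mathbb R^2$ containing $D=\{(b^2(x),s): x\in U,\ s^2\le b^2(x)\}$. Write $\phi_1=\partial\phi/\partial t$, $\phi_2=\partial\phi/\partial s$, and so on. Suppose that $F=\alpha\,\phi(b^2,\beta/\alpha)$ is a (positive definite) Finsler metric on $U$ which is not Riemannian. For a Finsler metric $F$ let $g_{ij}=\tfrac12[F^2]_{y^iy^j}$ and let $G^i=\tfrac14 g^{il}\{[F^2]_{x^my^l}y^m-[F^2]_{x^l}\}$ be its geodesic coefficients; those of $\alpha$ are denoted ${}^\alpha G^i$. $F$ is called projectively flat on $U$ if $G^i=Py^i$ with $P=F_{x^k}y^k/(2F)$ for all $x\in U$, $y\ne0$. Assume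 that $\alpha$ is projectively flat on $U$; that $\phi_1(b^2(x),0)\neq 0$ for all $x\in U$ (for instance, that $\phi_1$ vanishes nowhere on $D$); and that either $\phi_{22}$ does not vanish identically on $D$ or $b^2$ is not constant on $U$ (that is, exclude the case $F=\lambda\alpha+\mu\beta$ with constants $\lambda,\mu$ and $\|\beta\|_\alpha$ constant). Let $U^*=\{x\in U:\beta_x\ne 0\}$. Then $F$ is projectively flat on $U$ if and only if one of the following holds: (i) $\beta$ is parallel with respect to $\alpha$ on $U$; (ii) there are smooth functions $c=c(b^2)$, defined on the set of values of $b^2$ on $U^*$, and $k=k(x)$, defined on $U^*$, such that $$[cb^2-(c-1)s^2]\,\phi_{22}=2b^2(\phi_1-s\phi_{12})$$ for all $b^2=b^2(x)$ with $x\in U^*$ and all $s$ with $s^2\le b^2$, and $$b_{i|j}=kc\,(b^2a_{ij}-b_ib_j)+k\,b_ib_j\quad\text{on }U^*.$$ Moreover, whenever $c$ and $k$ are functions (smooth or not) satisfying the two equations in (ii), then for all $x\in U^*$ and $y\neq0$, with $s=\beta/\alpha$, $$G^i={}^\alpha G^i+k\alpha\Big\{(c-1)\frac{(b^2-s^2)\phi_2}{2\phi}+\frac{b^2(2s\phi_1+\phi_2)}{2\phi}\Big\}y^i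 .$$ -/

import Mathlib

open Matrix
open scoped ContDiff

noncomputable section

namespace GenAlphaBeta

/-- `∂f/∂xⁱ` for a function `f(x, y)` on `ℝⁿ × ℝⁿ`. -/
def dX {n : ℕ} (i : Fin n) (f : (Fin n → ℝ) → (Fin n → ℝ) → ℝ) :
    (Fin n → ℝ) → (Fin n → ℝ) → ℝ :=
  fun x y => fderiv ℝ (fun x' => f x' y) x (Pi.single i 1)

/-- `∂f/∂yⁱ` for a function `f(x, y)` on `ℝⁿ × ℝⁿ`. -/
def dY {n : ℕ} (i : Fin n) (f : (Fin n → ℝ) → (Fin n → ℝ) → ℝ) :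
    (Fin n → ℝ) → (Fin n → ℝ) → ℝ :=
  fun x y => fderiv ℝ (fun y' => f x y') y (Pi.single i 1)

/-! ### Finsler metrics on open subsets of `ℝⁿ` -/

/-- The fundamental tensor `g_{ij} = ½ [F²]_{yⁱ yʲ}`. -/
def fundTensor {n : ℕ} (F : (Fin n → ℝ) → (Fin n → ℝ) → ℝ) (x y : Fin n → ℝ) :
    Matrix (Fin n) (Fin n) ℝ :=
  Matrix.of fun i j => (1 / 2) * dY j (dY i (fun x y => F x y ^ 2)) x y

/-- `F` is a (positive definite) Finsler metric on `U`: it is smooth on the slit tangent bundle,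
positive there, positively homogeneous of degree one, and strongly convex. -/
structure IsFinslerOn {n : ℕ} (U : Set (Fin n → ℝ))
    (F : (Fin n → ℝ) → (Fin n → ℝ) → ℝ) : Prop where
  smooth : ContDiffOn ℝ ∞ (fun p : (Fin n → ℝ) × (Fin n → ℝ) => F p.1 p.2)
    (U ×ˢ ({0}ᶜ : Set (Fin n → ℝ)))
  pos : ∀ x ∈ U, ∀ y, y ≠ 0 → 0 < F x y
  homogeneous : ∀ x ∈ U, ∀ y, ∀ r : ℝ, 0 < r → F x (r • y) = r * F x y
  convex : ∀ x ∈ U, ∀ y, y ≠ 0 → (fundTensor F x y).PosDef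

/-- The geodesic coefficients
`Gⁱ = ¼ gⁱˡ ([F²]_{xᵐ yˡ} yᵐ - [F²]_{xˡ})`. -/
def spray {n : ℕ} (F : (Fin n → ℝ) → (Fin n → ℝ) → ℝ) (x y : Fin n → ℝ) (i : Fin n) : ℝ :=
  (1 / 4) * ∑ l, (fundTensor F x y)⁻¹ i l *
    ((∑ m, dY l (dX m (fun x y => F x y ^ 2)) x y * y m) - dX l (fun x y => F x y ^ 2) x y)

/-- The projective factor `P = F_{xᵏ} yᵏ / (2F)`. -/
def projFactor {n : ℕ} (F : (Fin n → ℝ) → (Fin n → ℝ) → ℝ) (x y : Fin n → ℝ) : ℝ :=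
  (∑ k, dX k F x y * y k) / (2 * F x y)

/-- `F` is projectively flat on `U`: `Gⁱ = P yⁱ`. -/
def IsProjectivelyFlatOn {n : ℕ} (U : Set (Fin n → ℝ))
    (F : (Fin n → ℝ) → (Fin n → ℝ) → ℝ) : Prop :=
  ∀ x ∈ U, ∀ y, y ≠ 0 → ∀ i, spray F x y i = projFactor F x y * y i

/-! ### Riemannian metrics and one-forms in coordinates -/

/-- `a = (a_{ij}(x))` is a smooth Riemannian metric on `U`. -/
def IsRiemannianOn {n : ℕ} (U : Set (Fin n → ℝ))
    (a : (Fin n → ℝ) → Matrix (Fin n) (Fin n) ℝ) : Prop :=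
  (∀ i j, ContDiffOn ℝ ∞ (fun x => a x i j) U) ∧ ∀ x ∈ U, (a x).PosDef

/-- `α(x, y) = √(a_{ij}(x) yⁱ yʲ)`. -/
def alpha {n : ℕ} (a : (Fin n → ℝ) → Matrix (Fin n) (Fin n) ℝ) (x y : Fin n → ℝ) : ℝ :=
  Real.sqrt (∑ i, ∑ j, a x i j * y i * y j)

/-- `β(x, y) = b_i(x) yⁱ`. -/
def beta {n : ℕ} (b : (Fin n → ℝ) → Fin n → ℝ) (x y : Fin n → ℝ) : ℝ :=
  ∑ i, b x i * y i

/-- `b² = ‖β_x‖²_α = a^{ij} b_i b_j`. -/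
def normSq {n : ℕ} (a : (Fin n → ℝ) → Matrix (Fin n) (Fin n) ℝ)
    (b : (Fin n → ℝ) → Fin n → ℝ) (x : Fin n → ℝ) : ℝ :=
  ∑ i, ∑ j, (a x)⁻¹ i j * b x i * b x j

/-- `∂f/∂xⁱ` for a function of `x` alone. -/
def pd {n : ℕ} (i : Fin n) (f : (Fin n → ℝ) → ℝ) (x : Fin n → ℝ) : ℝ :=
  fderiv ℝ f x (Pi.single i 1)

/-- The Christoffel symbols `Γᵐ_{ij}` of the Levi-Civita connection of `a`. -/
def christoffel {n : ℕ} (a : (Fin n → ℝ) → Matrix (Fin n) (Fin n) ℝ) (x : Fin n → ℝ)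
    (m i j : Fin n) : ℝ :=
  (1 / 2) * ∑ l, (a x)⁻¹ m l *
    (pd i (fun z => a z l j) x + pd j (fun z => a z l i) x - pd l (fun z => a z i j) x)

/-- The covariant derivative `b_{i|j} = ∂b_i/∂xʲ - Γᵐ_{ij} b_m` of `β` with respect to `α`. -/
def covDeriv {n : ℕ} (a : (Fin n → ℝ) → Matrix (Fin n) (Fin n) ℝ)
    (b : (Fin n → ℝ) → Fin n → ℝ) (x : Fin n → ℝ) (i j : Fin n) : ℝ :=
  pd j (fun z => b z i) x - ∑ m, christoffel a x m i j * b x m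

/-- `β` is parallel with respect to `α` on `U`. -/
def IsParallelOn {n : ℕ} (U : Set (Fin n → ℝ))
    (a : (Fin n → ℝ) → Matrix (Fin n) (Fin n) ℝ) (b : (Fin n → ℝ) → Fin n → ℝ) : Prop :=
  ∀ x ∈ U, ∀ i j, covDeriv a b x i j = 0

/-! ### General `(α, β)`-metrics -/

/-- The derivative `φ₁` of `φ = φ(b², s)` in its first variable `b²`. -/
def d1 (φ : ℝ → ℝ → ℝ) : ℝ → ℝ → ℝ := fun t s => deriv (fun t' => φ t' s) t

/-- The derivative `φ₂` of `φ = φ(b², s)` in its second variable `s`. -/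
def d2 (φ : ℝ → ℝ → ℝ) : ℝ → ℝ → ℝ := fun t s => deriv (fun s' => φ t s') s

/-- `F = α φ(b², β/α)`. -/
def metric {n : ℕ} (φ : ℝ → ℝ → ℝ) (a : (Fin n → ℝ) → Matrix (Fin n) (Fin n) ℝ)
    (b : (Fin n → ℝ) → Fin n → ℝ) (x y : Fin n → ℝ) : ℝ :=
  alpha a x y * φ (normSq a b x) (beta b x y / alpha a x y)

/-- `F` is a Riemannian metric on `U`. -/
def IsRiemannianFinslerOn {n : ℕ} (U : Set (Fin n → ℝ))
    (F : (Fin n → ℝ) → (Fin n → ℝ) → ℝ) : Prop :=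
  ∃ g, IsRiemannianOn U g ∧ ∀ x ∈ U, ∀ y, F x y = alpha g x y

/-- The set of points of `U` at which `β` does not vanish. -/
def nonzeroSet {n : ℕ} (U : Set (Fin n → ℝ)) (b : (Fin n → ℝ) → Fin n → ℝ) :
    Set (Fin n → ℝ) :=
  {x | x ∈ U ∧ b x ≠ 0}

/-- `[c b² - (c - 1) s²] φ₂₂ = 2 b² (φ₁ - s φ₁₂)` with `c = c(b²)`, for all values
`b² = ‖β_x‖²`, `|s| ≤ b`, and `b_{i|j} = k c (b² a_{ij} - b_i b_j) + k b_i b_j`, `k = k(x)`,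
both wherever `β` does not vanish. -/
def StructureEqs {n : ℕ} (U : Set (Fin n → ℝ)) (φ : ℝ → ℝ → ℝ)
    (a : (Fin n → ℝ) → Matrix (Fin n) (Fin n) ℝ) (b : (Fin n → ℝ) → Fin n → ℝ)
    (c : ℝ → ℝ) (k : (Fin n → ℝ) → ℝ) : Prop :=
  (∀ t ∈ normSq a b '' nonzeroSet U b, ∀ s : ℝ, s ^ 2 ≤ t →
    (c t * t - (c t - 1) * s ^ 2) * d2 (d2 φ) t s
      = 2 * t * (d1 φ t s - s * d2 (d1 φ) t s)) ∧
  (∀ x ∈ nonzeroSet U b, ∀ i j,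
    covDeriv a b x i j
      = k x * c (normSq a b x) * (normSq a b x * a x i j - b x i * b x j)
        + k x * (b x i * b x j))

/-- The factor
`k α { (c - 1) (b² - s²) φ₂ / (2φ) + b² (2 s φ₁ + φ₂) / (2φ) }`, with `s = β/α`. -/
def sprayFactor {n : ℕ} (φ : ℝ → ℝ → ℝ)
    (a : (Fin n → ℝ) → Matrix (Fin n) (Fin n) ℝ) (b : (Fin n → ℝ) → Fin n → ℝ)
    (c : ℝ → ℝ) (k : (Fin n → ℝ) → ℝ) (x y : Fin n → ℝ) : ℝ :=
  let t := normSq a b x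
  let s := beta b x y / alpha a x y
  k x * alpha a x y *
    ((c t - 1) * ((t - s ^ 2) * d2 φ t s / (2 * φ t s))
      + t * (2 * s * d1 φ t s + d2 φ t s) / (2 * φ t s))

end GenAlphaBeta

end

/-!
Why the theorem holds.

*Reduction to a tensor.* Euler's identity shows that the geodesic coefficients of a Finsler metric
`F` are `Gⁱ = P yⁱ + (F / 2) gⁱˡ H_l` with the Hamel tensor `H_l = F_{xᵐ yˡ} yᵐ - F_{xˡ}`
(`IsFinslerOn.spray_eq`), so projective flatness means `H = 0`. For `F = α φ(b², β/α)` with `α`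
projectively flat, `H` at a point `x` is an expression in `a_{ij}`, `b_i`, `b_{i|j}` and the
derivatives of `φ` alone (`hamel_metric`), because `α` itself has vanishing Hamel tensor and
`∂_k b² = 2 bⁱ b_{i|k}` (`pd_normSq`).

*Linear algebra at a point.* Suppose `H = 0` in all directions `y` at a point with `β ≠ 0`. Testing
with vectors orthogonal to `β` and to each other, which exist since `n ≥ 3`, shows that `d(b²)` is a
multiple `2 μ β` of `β` and that `2 φ₁(b², 0) μ α(y)² = φ₂₂(b², 0) b_{i|j} yⁱ yʲ` for `y` orthogonal
to `β` (`HamelFlat.orthogonal_eq`); moreover `β` is closed as soon as `φ₂(b², s) ≠ 0` for some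
interior `s ≠ 0` (`HamelFlat.symm`). If `φ₂₂(b², 0) ≠ 0`, these facts give the asserted form of
`b_{i|j}` with `c = 2 φ₁(b², 0) / φ₂₂(b², 0)` (`HamelFlat.form_eq`), and `H = 0` becomes the
differential equation for `φ` wherever `b_{i|j} ≠ 0` (`HamelFlat.ode`).

*Passing from points to `U`.* If `φ₂₂(t₀, 0) = 0` for a value `t₀ > 0` of `b²`, the relation above
gives `|d(b²)| ≤ C |b² - t₀|` near the level set `b² = t₀`; by Grönwall and connectedness `b² = t₀`
on `U`, and then `φ₂₂ ≢ 0` forces `b_{i|j} = 0` (`isParallelOn_of_degenerate`). Otherwise the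
differential equation could fail only at values of `b²` where `β` is parallel along the level. By
continuity it would then fail at all nearby values, `b²` would be locally constant there, hence
constant, and `β` would be parallel (`structureEqs_of_nondegenerate`).

*Converse.* The structure equations make `H` vanish identically where `β ≠ 0`. At a zero of `β` all
that is needed is that `β` is closed, and this extends from `U*` to `U`
(`StructureEqs.covDeriv_symm`). The formula for `Gⁱ` is the difference of the projective factors of
`F` and `α` (`StructureEqs.projFactor_eq`).
-/

noncomputable section

namespace GenAlphaBeta


/-! ### Linear algebra of the flatness equation at a point -/

section LinearAlgebra

variable {V : Type*} [AddCommGroup V] [Module ℝ V]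

/-- The Hamel tensor of `F = α φ(b², s)` at a point, contracted with a vector `z`. Here `A` is the
metric `a_{ij}`, `B` is `b_{i|j}`, `b` is the vector dual to `β`, and `α`, `s`, `p₁ = φ₁`,
`p₁₂ = φ₁₂`, `p₂ = φ₂`, `p₂₂ = φ₂₂` are plain numbers. -/
def hamelForm (A B : V →ₗ[ℝ] V →ₗ[ℝ] ℝ) (b : V) (α s p₁ p₁₂ p₂ p₂₂ : ℝ) (y z : V) : ℝ :=
  2 * B b y * (p₁ - s * p₁₂) * (A y z / α) + 2 * B b y * p₁₂ * A b z
    + p₂₂ * B y y * (A b z - s * (A y z / α)) / α + p₂ * (B z y - B y z) - 2 * α * p₁ * B b z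

/-- The vanishing of the Hamel tensor at a point in all directions `y` of unit length; the
functions `f₁, f₁₂, f₂, f₂₂` of `s` are the derivatives of `φ` at a fixed value of `b²`. -/
def HamelFlat (A B : V →ₗ[ℝ] V →ₗ[ℝ] ℝ) (b : V) (f₁ f₁₂ f₂ f₂₂ : ℝ → ℝ) : Prop :=
  ∀ y, A y y = 1 → ∀ z,
    hamelForm A B b 1 (A b y) (f₁ (A b y)) (f₁₂ (A b y)) (f₂ (A b y)) (f₂₂ (A b y)) y z = 0

/-- In dimension at least three, two linear functionals have a common nonzero zero. -/
lemma exists_ne_zero_of_two_functionals (hV : 3 ≤ Module.finrank ℝ V) (f g : V →ₗ[ℝ] ℝ) :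
    ∃ y, y ≠ 0 ∧ f y = 0 ∧ g y = 0 := by
  have : FiniteDimensional ℝ V := Module.finite_of_finrank_pos (by omega)
  have h : LinearMap.ker (f.prod g) ≠ ⊥ := by
    apply LinearMap.ker_ne_bot_of_finrank_lt
    simp
    omega
  obtain ⟨y, hy, hy0⟩ := Submodule.exists_mem_ne_zero_of_ne_bot h
  simp at hy
  exact ⟨y, hy0, hy.1, hy.2⟩

variable {A B : V →ₗ[ℝ] V →ₗ[ℝ] ℝ} {b : V} {f₁ f₁₂ f₂ f₂₂ : ℝ → ℝ}

lemma exists_smul_self_eq (hpos : ∀ y, y ≠ 0 → 0 < A y y) {y : V} (hy : y ≠ 0) {r : ℝ}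
    (hr : 0 < r) : ∃ m : ℝ, m ≠ 0 ∧ A (m • y) (m • y) = r := by
  have h := hpos y hy
  refine ⟨Real.sqrt (r / A y y), by positivity, ?_⟩
  simp only [map_smul, LinearMap.smul_apply, smul_eq_mul]
  rw [← mul_assoc, Real.mul_self_sqrt (by positivity)]
  field_simp

/-- The differential of `b²` is proportional to `β`. -/
lemma HamelFlat.apply_eq_zero (h : HamelFlat A B b f₁ f₁₂ f₂ f₂₂)
    (hV : 3 ≤ Module.finrank ℝ V) (hpos : ∀ y, y ≠ 0 → 0 < A y y)
    (h1 : f₁ 0 ≠ 0) {z : V} (hz : A b z = 0) : B b z = 0 := by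
  obtain ⟨y, hy0, hyb, hyz⟩ := exists_ne_zero_of_two_functionals hV (A b) (A.flip z)
  obtain ⟨m, -, hm1⟩ := exists_smul_self_eq hpos hy0 one_pos
  have hb' : A b (m • y) = 0 := by simp [hyb]
  have hz' : A (m • y) z = 0 := by simp at hyz; simp [hyz]
  generalize m • y = w at hm1 hb' hz'
  have e1 := h w hm1 z
  have e2 := h (-w) (by simpa using hm1) z
  simp only [hamelForm, map_neg, LinearMap.neg_apply, hb', hz', hz, neg_zero] at e1 e2
  have : f₁ 0 * B b z = 0 := by linarith
  exact (mul_eq_zero.1 this).resolve_left h1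

/-- On the orthogonal complement of `β`, the form `b_{i|j} yⁱ yʲ` is determined up to the factor
`φ₂₂(b², 0)`. -/
lemma HamelFlat.orthogonal_eq (h : HamelFlat A B b f₁ f₁₂ f₂ f₂₂)
    (hV : 3 ≤ Module.finrank ℝ V) (hpos : ∀ y, y ≠ 0 → 0 < A y y) (hsymm : ∀ y z, A y z = A z y)
    (h1 : f₁ 0 ≠ 0) {y : V} (hy : A b y = 0) :
    2 * f₁ 0 * B b b * A y y = f₂₂ 0 * A b b * B y y := by
  rcases eq_or_ne y 0 with rfl | hy0
  · simp
  obtain ⟨m, hm0, hm1⟩ := exists_smul_self_eq hpos hy0 one_pos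
  have hv := h.apply_eq_zero hV hpos h1 hy
  have hy' := hsymm b y
  have e1 := h (m • y) hm1 b
  have e2 := h (-(m • y)) (by simpa using hm1) b
  simp only [hamelForm, map_neg, map_smul, LinearMap.neg_apply, LinearMap.smul_apply, smul_eq_mul,
    hy, hv, ← hy', mul_zero, neg_zero] at e1 e2 hm1
  have e3 : f₂₂ 0 * (m * (m * B y y)) * A b b = 2 * f₁ 0 * B b b := by linarith
  have e4 : m * m ≠ 0 := by positivity
  have : (m * m) * (2 * f₁ 0 * B b b * A y y - f₂₂ 0 * A b b * B y y) = 0 := by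
    linear_combination 2 * f₁ 0 * B b b * hm1 - e3
  linarith [(mul_eq_zero.1 this).resolve_left e4]

lemma HamelFlat.apply_eq (h : HamelFlat A B b f₁ f₁₂ f₂ f₂₂)
    (hV : 3 ≤ Module.finrank ℝ V) (hpos : ∀ y, y ≠ 0 → 0 < A y y)
    (hb : b ≠ 0) (h1 : f₁ 0 ≠ 0) (z : V) : A b b * B b z = B b b * A b z := by
  have hbb := (hpos b hb).ne'
  have := h.apply_eq_zero hV hpos h1 (z := z - (A b z / A b b) • b) (by simp; field_simp; simp)
  simp only [map_sub, map_smul, smul_eq_mul] at this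
  field_simp at this
  linarith

/-- If `φ₂` is nonzero somewhere in the interior, away from `s = 0`, then `β` is closed. -/
lemma HamelFlat.symm (h : HamelFlat A B b f₁ f₁₂ f₂ f₂₂)
    (hV : 3 ≤ Module.finrank ℝ V) (hpos : ∀ y, y ≠ 0 → 0 < A y y) (hsymm : ∀ y z, A y z = A z y)
    (hb : b ≠ 0) (h1 : f₁ 0 ≠ 0) {s : ℝ} (hs0 : s ≠ 0) (hs : s ^ 2 < A b b) (hf : f₂ s ≠ 0)
    (z w : V) : B z w = B w z := by
  have hbb := hpos b hb
  -- For `z, y` orthogonal to each other and to `β`, test with the unit vectors `(s / b²) b ± y`.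
  have key : ∀ z y, A b z = 0 → A b y = 0 → A y z = 0 → A y y = 1 - s ^ 2 / A b b →
      B z b = B b z ∧ B z y = B y z := by
    intro z y hz hy hyz hyy
    have hv := h.apply_eq_zero hV hpos h1 hz
    have aux : ∀ y, A b y = 0 → A y z = 0 → A y y = 1 - s ^ 2 / A b b →
        s / A b b * (B z b - B b z) + (B z y - B y z) = 0 := by
      intro y hy hyz hyy
      have hs' : A b ((s / A b b) • b + y) = s := by simp [hy]; field_simp
      have e := h ((s / A b b) • b + y) (by
        simp only [map_add, map_smul, LinearMap.add_apply, LinearMap.smul_apply, smul_eq_mul, hy,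
          hsymm y b, hyy]
        field_simp; ring) z
      rw [hs'] at e
      simp only [hamelForm, map_add, map_smul, LinearMap.add_apply, LinearMap.smul_apply,
        smul_eq_mul, hz, hyz, hv] at e
      have : f₂ s * (s / A b b * (B z b - B b z) + (B z y - B y z)) = 0 := by
        linear_combination e - f₂ s * (s / A b b) * hv
      exact (mul_eq_zero.1 this).resolve_left hf
    have e1 := aux y hy hyz hyy
    have e2 := aux (-y) (by simp [hy]) (by simp [hyz]) (by simp [hyy])
    simp only [map_neg, LinearMap.neg_apply] at e2
    have e3 : s / A b b * (B z b - B b z) = 0 := by linarith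
    have e4 := (mul_eq_zero.1 e3).resolve_left (by positivity)
    exact ⟨by linarith, by linarith⟩
  have hr : 0 < 1 - s ^ 2 / A b b := by
    rw [sub_pos, div_lt_one hbb]; exact hs
  have k1 : ∀ z, A b z = 0 → B z b = B b z := by
    intro z hz
    obtain ⟨y, hy0, hyb, hyz⟩ := exists_ne_zero_of_two_functionals hV (A b) (A.flip z)
    obtain ⟨m, -, hm⟩ := exists_smul_self_eq hpos hy0 hr
    simp at hyz
    exact (key z (m • y) hz (by simp [hyb]) (by simp [hyz]) hm).1
  have k2 : ∀ z y, A b z = 0 → A b y = 0 → A y z = 0 → B z y = B y z := by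
    intro z y hz hy hyz
    rcases eq_or_ne y 0 with rfl | hy0
    · simp
    obtain ⟨m, hm0, hm⟩ := exists_smul_self_eq hpos hy0 hr
    have := (key z (m • y) hz (by simp [hy]) (by simp [hyz]) hm).2
    simp only [map_smul, LinearMap.smul_apply, smul_eq_mul] at this
    exact mul_left_cancel₀ hm0 this
  have k3 : ∀ z y, A b z = 0 → A b y = 0 → B z y = B y z := by
    intro z y hz hy
    rcases eq_or_ne z 0 with rfl | hz0
    · simp
    have hzz := (hpos z hz0).ne'
    have := k2 z (y - (A z y / A z z) • z) hz (by simp [hz, hy]) (by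
      simp [hsymm y z]; field_simp; simp)
    simp only [map_sub, map_smul, LinearMap.sub_apply, LinearMap.smul_apply, smul_eq_mul] at this
    linarith
  have h0 : ∀ z, A b (z - (A b z / A b b) • b) = 0 := by
    intro z; simp; field_simp; simp
  have e1 := k3 _ _ (h0 z) (h0 w)
  have e2 := k1 _ (h0 z)
  have e3 := k1 _ (h0 w)
  simp only [map_sub, map_smul, LinearMap.sub_apply, LinearMap.smul_apply, smul_eq_mul] at e1 e2 e3
  linear_combination e1 + (A b w / A b b) * e2 - (A b z / A b b) * e3

/-- Once `β` is closed, the flatness equation is a single scalar equation. -/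
lemma HamelFlat.scalar_eq (h : HamelFlat A B b f₁ f₁₂ f₂ f₂₂)
    (hV : 3 ≤ Module.finrank ℝ V) (hpos : ∀ y, y ≠ 0 → 0 < A y y) (hsymm : ∀ y z, A y z = A z y)
    (hb : b ≠ 0) (h1 : f₁ 0 ≠ 0) (hB : ∀ z w, B z w = B w z) {y : V} (hy : A y y = 1)
    (hs : A b y ^ 2 < A b b) :
    A b b * (f₂₂ (A b y) * B y y) = 2 * B b b * (f₁ (A b y) - A b y * f₁₂ (A b y)) := by
  have e := h y hy b
  have e2 := h.apply_eq hV hpos hb h1 y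
  simp only [hamelForm, hB y b, hsymm y b] at e
  have : (A b b - A b y ^ 2) * (A b b * (f₂₂ (A b y) * B y y)
      - 2 * B b b * (f₁ (A b y) - A b y * f₁₂ (A b y))) = 0 := by
    linear_combination A b b * e - (2 * (f₁ (A b y) - A b y * f₁₂ (A b y)) * A b y
      + 2 * f₁₂ (A b y) * A b b) * e2
  have := (mul_eq_zero.1 this).resolve_left (by linarith)
  linarith

/-- For every `s` with `s² < b²` there are unit vectors `y` with `β(y) = s`, and the component of
`y` orthogonal to `β` may be prescribed up to scaling. -/
lemma exists_unit_of_orthogonal (hpos : ∀ y, y ≠ 0 → 0 < A y y) (hsymm : ∀ y z, A y z = A z y)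
    (hb : b ≠ 0) {s : ℝ} (hs : s ^ 2 < A b b) {w : V} (hw0 : w ≠ 0) (hw : A b w = 0) :
    ∃ m : ℝ, m ≠ 0 ∧ A b ((s / A b b) • b + m • w) = s ∧
      A ((s / A b b) • b + m • w) ((s / A b b) • b + m • w) = 1 := by
  have hbb := hpos b hb
  have hr : 0 < 1 - s ^ 2 / A b b := by
    rw [sub_pos, div_lt_one hbb]; exact hs
  obtain ⟨m, hm0, hm⟩ := exists_smul_self_eq hpos hw0 hr
  refine ⟨m, hm0, by simp [hw]; field_simp, ?_⟩
  have hwb : A (m • w) b = 0 := by rw [hsymm]; simp [hw]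
  have hbw : A b (m • w) = 0 := by simp [hw]
  generalize m • w = u at *
  simp only [map_add, map_smul, LinearMap.add_apply, LinearMap.smul_apply, smul_eq_mul, hm, hwb,
    hbw]
  field_simp
  ring

/-- A symmetric bilinear form is determined by its quadratic form. -/
lemma eq_of_quadratic_eq {B C : V →ₗ[ℝ] V →ₗ[ℝ] ℝ} (hB : ∀ z w, B z w = B w z)
    (hC : ∀ z w, C z w = C w z) (h : ∀ y, B y y = C y y) (z w : V) : B z w = C z w := by
  have h1 := h (z + w)
  simp only [map_add, LinearMap.add_apply, hB w z, hC w z, h z, h w] at h1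
  linarith

lemma quadratic_decomp (hpos : ∀ y, y ≠ 0 → 0 < A y y) (hb : b ≠ 0) (y : V) :
    ∃ w, A b w = 0 ∧ y = (A b y / A b b) • b + w := by
  have hbb := (hpos b hb).ne'
  refine ⟨y - (A b y / A b b) • b, ?_, by abel⟩
  simp; field_simp; simp

/-- If `φ₂₂(b², 0) = 0` while `φ₂₂` and `φ₂` are both nonzero at some interior `s ≠ 0`, then the
covariant derivative of `β` vanishes. -/
lemma HamelFlat.eq_zero (h : HamelFlat A B b f₁ f₁₂ f₂ f₂₂)
    (hV : 3 ≤ Module.finrank ℝ V) (hpos : ∀ y, y ≠ 0 → 0 < A y y) (hsymm : ∀ y z, A y z = A z y)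
    (hb : b ≠ 0) (h1 : f₁ 0 ≠ 0) (h22 : f₂₂ 0 = 0) {s : ℝ} (hs0 : s ≠ 0) (hs : s ^ 2 < A b b)
    (hf : f₂ s ≠ 0) (hf2 : f₂₂ s ≠ 0) (z w : V) : B z w = 0 := by
  have hbb := hpos b hb
  have hB := h.symm hV hpos hsymm hb h1 hs0 hs hf
  have hbb0 : B b b = 0 := by
    obtain ⟨y, hy0, hyb, -⟩ := exists_ne_zero_of_two_functionals hV (A b) (A b)
    have := h.orthogonal_eq hV hpos hsymm h1 hyb
    rw [h22, zero_mul, zero_mul] at this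
    have hyy := (hpos y hy0).ne'
    simpa [h1, hyy] using this
  have hw : ∀ w, A b w = 0 → B w w = 0 := by
    intro w hw
    rcases eq_or_ne w 0 with rfl | hw0
    · simp
    obtain ⟨m, hm0, hm1, hm2⟩ := exists_unit_of_orthogonal hpos hsymm hb hs hw0 hw
    have e := h.scalar_eq hV hpos hsymm hb h1 hB hm2 (by rw [hm1]; exact hs)
    rw [hm1, hbb0] at e
    have hv := h.apply_eq_zero hV hpos h1 hw
    simp only [map_add, map_smul, LinearMap.add_apply, LinearMap.smul_apply, smul_eq_mul, hB w b,
      hv, hbb0] at e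
    simpa [hbb.ne', hf2, hm0] using e
  refine eq_of_quadratic_eq (C := 0) hB (by simp) (fun y => ?_) z w
  obtain ⟨w, hwb, hy⟩ := quadratic_decomp hpos hb y
  have hv := h.apply_eq_zero hV hpos h1 hwb
  rw [hy]
  simp [hB w b, hv, hbb0, hw w hwb]

/-- If `φ₂₂(b², 0) ≠ 0`, the covariant derivative of `β` has the two-parameter form
`τ (a - ββ / b²) + μ ββ / b²`, where `μ = b_{i|j} bⁱ bʲ / b²` and `τ = 2 φ₁ μ / φ₂₂` at `s = 0`. -/
lemma HamelFlat.form_eq (h : HamelFlat A B b f₁ f₁₂ f₂ f₂₂)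
    (hV : 3 ≤ Module.finrank ℝ V) (hpos : ∀ y, y ≠ 0 → 0 < A y y) (hsymm : ∀ y z, A y z = A z y)
    (hb : b ≠ 0) (h1 : f₁ 0 ≠ 0) (h22 : f₂₂ 0 ≠ 0) (hB : ∀ z w, B z w = B w z) (z w : V) :
    B z w = B b b / A b b ^ 2 * (2 * f₁ 0 / f₂₂ 0) * (A b b * A z w - A b z * A b w)
      + B b b / A b b ^ 2 * (A b z * A b w) := by
  have hbb := (hpos b hb).ne'
  let C : V →ₗ[ℝ] V →ₗ[ℝ] ℝ :=
    (B b b / A b b ^ 2 * (2 * f₁ 0 / f₂₂ 0)) • (A b b • A - (A b).smulRight (A b))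
      + (B b b / A b b ^ 2) • (A b).smulRight (A b)
  have hC : ∀ z w, C z w = B b b / A b b ^ 2 * (2 * f₁ 0 / f₂₂ 0) *
      (A b b * A z w - A b z * A b w) + B b b / A b b ^ 2 * (A b z * A b w) := by
    intro z w; simp [C]
  rw [← hC]
  refine eq_of_quadratic_eq hB (fun z w => ?_) (fun y => ?_) z w
  · rw [hC, hC, hsymm w z]; ring
  obtain ⟨w, hwb, hy⟩ := quadratic_decomp hpos hb y
  have hv := h.apply_eq_zero hV hpos h1 hwb
  have e := h.orthogonal_eq hV hpos hsymm h1 hwb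
  rw [hC, hy]
  generalize A b y / A b b = r
  simp only [map_add, map_smul, LinearMap.add_apply, LinearMap.smul_apply, smul_eq_mul, hB w b,
      hv, hwb, hsymm w b]
  field_simp
  linear_combination -(A b b) * e

/-- The differential equation for `φ` along the fibre, at points where `b_{i|j} bⁱ bʲ ≠ 0`. -/
lemma HamelFlat.ode (h : HamelFlat A B b f₁ f₁₂ f₂ f₂₂)
    (hV : 3 ≤ Module.finrank ℝ V) (hpos : ∀ y, y ≠ 0 → 0 < A y y) (hsymm : ∀ y z, A y z = A z y)
    (hb : b ≠ 0) (h1 : f₁ 0 ≠ 0) (h22 : f₂₂ 0 ≠ 0) (hB : ∀ z w, B z w = B w z)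
    (hbb0 : B b b ≠ 0) {s : ℝ} (hs : s ^ 2 < A b b) :
    (2 * f₁ 0 / f₂₂ 0 * A b b - (2 * f₁ 0 / f₂₂ 0 - 1) * s ^ 2) * f₂₂ s
      = 2 * A b b * (f₁ s - s * f₁₂ s) := by
  have hbb := (hpos b hb).ne'
  obtain ⟨w, hw0, hwb, -⟩ := exists_ne_zero_of_two_functionals hV (A b) (A b)
  obtain ⟨m, -, hm1, hm2⟩ := exists_unit_of_orthogonal hpos hsymm hb hs hw0 hwb
  have e := h.scalar_eq hV hpos hsymm hb h1 hB hm2 (by rw [hm1]; exact hs)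
  rw [h.form_eq hV hpos hsymm hb h1 h22 hB, hm1, hm2] at e
  have : B b b * ((2 * f₁ 0 / f₂₂ 0 * A b b - (2 * f₁ 0 / f₂₂ 0 - 1) * s ^ 2) * f₂₂ s
      - 2 * A b b * (f₁ s - s * f₁₂ s)) = 0 := by
    field_simp at e ⊢
    linear_combination B b b * e
  linarith [(mul_eq_zero.1 this).resolve_left hbb0]

/-- Sufficiency of the structure equations for the vanishing of the Hamel tensor. -/
lemma hamelForm_eq_zero {c k α s p₁ p₁₂ p₂ p₂₂ : ℝ} (hα : α ≠ 0) {y : V}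
    (hsymm : ∀ y z, A y z = A z y) (hαy : A y y = α ^ 2) (hs : A b y = s * α)
    (hB : ∀ z w, B z w = k * c * (A b b * A z w - A b z * A b w) + k * (A b z * A b w))
    (hode : (c * A b b - (c - 1) * s ^ 2) * p₂₂ = 2 * A b b * (p₁ - s * p₁₂)) (z : V) :
    hamelForm A B b α s p₁ p₁₂ p₂ p₂₂ y z = 0 := by
  simp only [hamelForm, hB, hαy, hs, hsymm z y]
  field_simp
  linear_combination k * (A b z * α - A y z * s) * hode

end LinearAlgebra


/-! ### Partial derivatives on open sets -/

section Calculus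

variable {n : ℕ} {W : Set ((Fin n → ℝ) × (Fin n → ℝ))} {f g : (Fin n → ℝ) → (Fin n → ℝ) → ℝ}
  {x y : Fin n → ℝ}

/-- `f(x, y)` is smooth on `W`. -/
def SmoothOn (W : Set ((Fin n → ℝ) × (Fin n → ℝ))) (f : (Fin n → ℝ) → (Fin n → ℝ) → ℝ) : Prop :=
  ContDiffOn ℝ ∞ (fun p : (Fin n → ℝ) × (Fin n → ℝ) => f p.1 p.2) W

lemma SmoothOn.hasFDerivAt (hf : SmoothOn W f) (hW : IsOpen W) (h : (x, y) ∈ W) :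
    HasFDerivAt (fun p : (Fin n → ℝ) × (Fin n → ℝ) => f p.1 p.2)
      (fderiv ℝ (fun p : (Fin n → ℝ) × (Fin n → ℝ) => f p.1 p.2) (x, y)) (x, y) :=
  ((hf.contDiffAt (hW.mem_nhds h)).differentiableAt (by simp)).hasFDerivAt

lemma SmoothOn.hasFDerivAt_left (hf : SmoothOn W f) (hW : IsOpen W) (h : (x, y) ∈ W) :
    HasFDerivAt (fun x' => f x' y)
      ((fderiv ℝ (fun p : (Fin n → ℝ) × (Fin n → ℝ) => f p.1 p.2) (x, y)).comp
        (ContinuousLinearMap.inl ℝ (Fin n → ℝ) (Fin n → ℝ))) x :=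
  HasFDerivAt.comp (g := fun p : (Fin n → ℝ) × (Fin n → ℝ) => f p.1 p.2)
    (f := fun x' => (x', y)) x
    (hf.hasFDerivAt hW h) (hasFDerivAt_prodMk_left x y)

lemma SmoothOn.hasFDerivAt_right (hf : SmoothOn W f) (hW : IsOpen W) (h : (x, y) ∈ W) :
    HasFDerivAt (fun y' => f x y')
      ((fderiv ℝ (fun p : (Fin n → ℝ) × (Fin n → ℝ) => f p.1 p.2) (x, y)).comp
        (ContinuousLinearMap.inr ℝ (Fin n → ℝ) (Fin n → ℝ))) y :=
  HasFDerivAt.comp (g := fun p : (Fin n → ℝ) × (Fin n → ℝ) => f p.1 p.2) y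
    (hf.hasFDerivAt hW h) (hasFDerivAt_prodMk_right x y)

lemma SmoothOn.dX (hf : SmoothOn W f) (hW : IsOpen W) (i : Fin n) : SmoothOn W (dX i f) := by
  refine ContDiffOn.congr (f := fun p => fderiv ℝ
    (fun p : (Fin n → ℝ) × (Fin n → ℝ) => f p.1 p.2) p (Pi.single i 1, 0)) ?_ ?_
  · exact (hf.fderiv_of_isOpen hW (m := ∞) (by simp)).clm_apply contDiffOn_const
  · rintro ⟨x, y⟩ h
    simp only [GenAlphaBeta.dX, (hf.hasFDerivAt_left hW h).fderiv]
    simp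

lemma SmoothOn.dY (hf : SmoothOn W f) (hW : IsOpen W) (i : Fin n) : SmoothOn W (dY i f) := by
  refine ContDiffOn.congr (f := fun p => fderiv ℝ
    (fun p : (Fin n → ℝ) × (Fin n → ℝ) => f p.1 p.2) p (0, Pi.single i 1)) ?_ ?_
  · exact (hf.fderiv_of_isOpen hW (m := ∞) (by simp)).clm_apply contDiffOn_const
  · rintro ⟨x, y⟩ h
    simp only [GenAlphaBeta.dY, (hf.hasFDerivAt_right hW h).fderiv]
    simp

/-- The line through `x` in the `i`-th coordinate direction. -/
def coordLine (x : Fin n → ℝ) (i : Fin n) (r : ℝ) : Fin n → ℝ := x + r • Pi.single i 1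

@[simp] lemma coordLine_zero (x : Fin n → ℝ) (i : Fin n) : coordLine x i 0 = x := by
  simp [coordLine]

lemma hasDerivAt_coordLine (x : Fin n → ℝ) (i : Fin n) (r : ℝ) :
    HasDerivAt (coordLine x i) (Pi.single i 1) r := by
  unfold coordLine
  simpa using ((hasDerivAt_id r).smul_const (Pi.single i (1 : ℝ) : Fin n → ℝ)).const_add x

lemma continuous_coordLine (x : Fin n → ℝ) (i : Fin n) : Continuous (coordLine x i) :=
  continuous_iff_continuousAt.2 fun r => (hasDerivAt_coordLine x i r).continuousAt

lemma hasDerivAt_coordLine_apply (x : Fin n → ℝ) (i j : Fin n) :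
    HasDerivAt (fun r => coordLine x i r j) (if j = i then 1 else 0) 0 := by
  have := (hasDerivAt_pi.1 (hasDerivAt_coordLine x i 0)) j
  simpa [Pi.single_apply] using this

lemma hasDerivAt_comp_coordLine {f : (Fin n → ℝ) → ℝ} (h : DifferentiableAt ℝ f x) (i : Fin n) :
    HasDerivAt (fun r => f (coordLine x i r)) (fderiv ℝ f x (Pi.single i 1)) 0 := by
  have h' : HasFDerivAt f (fderiv ℝ f x) (coordLine x i 0) := by simpa using h.hasFDerivAt
  exact h'.comp_hasDerivAt 0 (hasDerivAt_coordLine x i 0)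

lemma SmoothOn.hasDerivAt_dX (hf : SmoothOn W f) (hW : IsOpen W) (h : (x, y) ∈ W) (i : Fin n) :
    HasDerivAt (fun r => f (coordLine x i r) y) (GenAlphaBeta.dX i f x y) 0 :=
  hasDerivAt_comp_coordLine (hf.hasFDerivAt_left hW h).differentiableAt i

lemma SmoothOn.hasDerivAt_dY (hf : SmoothOn W f) (hW : IsOpen W) (h : (x, y) ∈ W) (i : Fin n) :
    HasDerivAt (fun r => f x (coordLine y i r)) (GenAlphaBeta.dY i f x y) 0 :=
  hasDerivAt_comp_coordLine (hf.hasFDerivAt_right hW h).differentiableAt i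

lemma eventually_coordLine_left (hW : IsOpen W) (h : (x, y) ∈ W) (i : Fin n) :
    ∀ᶠ r in nhds (0 : ℝ), (coordLine x i r, y) ∈ W := by
  have : Continuous fun r => (coordLine x i r, y) := 
    (continuous_coordLine x i).prodMk continuous_const
  exact this.continuousAt.eventually_mem (hW.mem_nhds (by simpa using h))

lemma eventually_coordLine_right (hW : IsOpen W) (h : (x, y) ∈ W) (i : Fin n) :
    ∀ᶠ r in nhds (0 : ℝ), (x, coordLine y i r) ∈ W := by
  have : Continuous fun r => (x, coordLine y i r) := 
    continuous_const.prodMk (continuous_coordLine y i)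
  exact this.continuousAt.eventually_mem (hW.mem_nhds (by simpa using h))

/-- To compute `∂f/∂xⁱ` one may replace `f` by an expression that agrees with it on `W`. -/
lemma SmoothOn.dX_eq (hf : SmoothOn W f) (hW : IsOpen W) (h : (x, y) ∈ W) {i : Fin n} {d : ℝ}
    (hfg : ∀ x y, (x, y) ∈ W → f x y = g x y)
    (hd : HasDerivAt (fun r => g (coordLine x i r) y) d 0) : GenAlphaBeta.dX i f x y = d :=
  (hf.hasDerivAt_dX hW h i).unique (hd.congr_of_eventuallyEq
    ((eventually_coordLine_left hW h i).mono fun _ hr => hfg _ _ hr))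

/-- To compute `∂f/∂yⁱ` one may replace `f` by an expression that agrees with it on `W`. -/
lemma SmoothOn.dY_eq (hf : SmoothOn W f) (hW : IsOpen W) (h : (x, y) ∈ W) {i : Fin n} {d : ℝ}
    (hfg : ∀ y, (x, y) ∈ W → f x y = g x y)
    (hd : HasDerivAt (fun r => g x (coordLine y i r)) d 0) : GenAlphaBeta.dY i f x y = d :=
  (hf.hasDerivAt_dY hW h i).unique (hd.congr_of_eventuallyEq
    ((eventually_coordLine_right hW h i).mono fun _ hr => hfg _ hr))

lemma isOpen_slit {U : Set (Fin n → ℝ)} (hU : IsOpen U) :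
    IsOpen (U ×ˢ ({0}ᶜ : Set (Fin n → ℝ))) := hU.prod isOpen_compl_singleton

lemma SmoothOn.sq (hf : SmoothOn W f) : SmoothOn W (fun x y => f x y ^ 2) :=
  ContDiffOn.pow hf 2

lemma dX_sq (hf : SmoothOn W f) (hW : IsOpen W) (h : (x, y) ∈ W) (i : Fin n) :
    dX i (fun x y => f x y ^ 2) x y = 2 * f x y * dX i f x y := by
  refine hf.sq.dX_eq (g := fun x y => f x y ^ 2) hW h (fun _ _ _ => rfl) ?_
  simpa using (hf.hasDerivAt_dX hW h i).fun_pow 2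

lemma dY_sq (hf : SmoothOn W f) (hW : IsOpen W) (h : (x, y) ∈ W) (i : Fin n) :
    dY i (fun x y => f x y ^ 2) x y = 2 * f x y * dY i f x y := by
  refine hf.sq.dY_eq (g := fun x y => f x y ^ 2) hW h (fun _ _ => rfl) ?_
  simpa using (hf.hasDerivAt_dY hW h i).fun_pow 2

lemma dY_dX_sq (hf : SmoothOn W f) (hW : IsOpen W) (h : (x, y) ∈ W) (l m : Fin n) :
    dY l (dX m (fun x y => f x y ^ 2)) x y
      = 2 * (dY l f x y * dX m f x y + f x y * dY l (dX m f) x y) := by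
  refine (hf.sq.dX hW m).dY_eq hW h (g := fun x y => 2 * (f x y * dX m f x y)) ?_ ?_
  · intro y hy
    rw [dX_sq hf hW hy m, mul_assoc]
  · simpa using ((hf.hasDerivAt_dY hW h l).fun_mul ((hf.dX hW m).hasDerivAt_dY hW h l)).const_mul 2

lemma dX_congr (hW : IsOpen W) (h : (x, y) ∈ W) (hfg : ∀ x y, (x, y) ∈ W → f x y = g x y)
    (i : Fin n) : dX i f x y = dX i g x y := by
  have : (fun x' => f x' y) =ᶠ[nhds x] fun x' => g x' y := by
    have hc : ContinuousAt (fun x' : Fin n → ℝ => (x', y)) x := by fun_prop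
    filter_upwards [hc.eventually_mem (hW.mem_nhds h)] with x' hx' using hfg _ _ hx'
  simp only [dX, this.fderiv_eq]

lemma dY_congr (hW : IsOpen W) (h : (x, y) ∈ W) (hfg : ∀ x y, (x, y) ∈ W → f x y = g x y)
    (i : Fin n) : dY i f x y = dY i g x y := by
  have : (fun y' => f x y') =ᶠ[nhds y] fun y' => g x y' := by
    have hc : ContinuousAt (fun y' : Fin n → ℝ => (x, y')) y := by fun_prop
    filter_upwards [hc.eventually_mem (hW.mem_nhds h)] with y' hy' using hfg _ _ hy'
  simp only [dY, this.fderiv_eq]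

end Calculus

/-! ### Hamel's criterion for projective flatness -/

section Hamel

variable {n : ℕ} {U : Set (Fin n → ℝ)} {F : (Fin n → ℝ) → (Fin n → ℝ) → ℝ} {x y : Fin n → ℝ}

/-- The Hamel tensor `F_{xᵐ yˡ} yᵐ - F_{xˡ}`. -/
def hamel (F : (Fin n → ℝ) → (Fin n → ℝ) → ℝ) (x y : Fin n → ℝ) (l : Fin n) : ℝ :=
  (∑ m, dY l (dX m F) x y * y m) - dX l F x y

lemma IsFinslerOn.smoothOn (hF : IsFinslerOn U F) :
    SmoothOn (U ×ˢ ({0}ᶜ : Set (Fin n → ℝ))) F := hF.smooth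

/-- Euler's identity for the homogeneous function `F`. -/
lemma IsFinslerOn.euler (hF : IsFinslerOn U F) (hU : IsOpen U) (hx : x ∈ U) (hy : y ≠ 0) :
    ∑ j, y j * dY j F x y = F x y := by
  have hd := (hF.smoothOn.hasFDerivAt_right (isOpen_slit hU) (x := x) (y := y)
    ⟨hx, hy⟩).differentiableAt.hasFDerivAt
  have h1 : HasDerivAt (fun r : ℝ => F x (r • y)) (fderiv ℝ (fun y' => F x y') y y) 1 := by
    have hr : HasDerivAt (fun r : ℝ => r • y) y 1 := by
      simpa using (hasDerivAt_id (1 : ℝ)).smul_const y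
    have hd' : HasFDerivAt (fun y' => F x y') (fderiv ℝ (fun y' => F x y') y) ((1 : ℝ) • y) := by
      simpa using hd
    exact hd'.comp_hasDerivAt 1 hr
  have h2 : HasDerivAt (fun r : ℝ => F x (r • y)) (F x y) 1 := by
    have : HasDerivAt (fun r : ℝ => r * F x y) (F x y) 1 := by
      simpa using (hasDerivAt_id (1 : ℝ)).mul_const (F x y)
    refine this.congr_of_eventuallyEq ?_
    filter_upwards [lt_mem_nhds (zero_lt_one (α := ℝ))] with r hr
    exact hF.homogeneous x hx y r hr
  rw [← h1.unique h2]
  have h3 : fderiv ℝ (fun y' => F x y') y y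
      = fderiv ℝ (fun y' => F x y') y (∑ j, y j • Pi.single j 1) := by
    congr 1
    exact pi_eq_sum_univ' y
  rw [h3]
  simp [dY, map_sum]

/-- The fundamental tensor satisfies `g_{jl} yʲ = F F_{yˡ}`. -/
lemma IsFinslerOn.sum_fundTensor (hF : IsFinslerOn U F) (hU : IsOpen U) (hx : x ∈ U)
    (hy : y ≠ 0) (l : Fin n) :
    ∑ j, fundTensor F x y j l * y j = F x y * dY l F x y := by
  have hW := isOpen_slit hU
  have hs := hF.smoothOn
  have hxy : (x, y) ∈ U ×ˢ ({0}ᶜ : Set (Fin n → ℝ)) := ⟨hx, hy⟩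
  have h1 : dY l (fun x y => F x y ^ 2) x y
      = (1 / 2) * ∑ j, ((if j = l then 1 else 0) * dY j (fun x y => F x y ^ 2) x y
        + y j * dY l (dY j (fun x y => F x y ^ 2)) x y) := by
    refine hs.sq.dY_eq hW hxy
      (g := fun x y => (1 / 2) * ∑ j, y j * dY j (fun x y => F x y ^ 2) x y) ?_ ?_
    · intro y hy
      have := hF.euler hU hx hy.2
      calc F x y ^ 2 = F x y * ∑ j, y j * dY j F x y := by rw [this, sq]
        _ = _ := by
          rw [Finset.mul_sum, Finset.mul_sum]
          refine Finset.sum_congr rfl fun j _ => ?_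
          rw [dY_sq hs hW hy]
          ring
    · refine HasDerivAt.const_mul _ (HasDerivAt.fun_sum fun j _ => ?_)
      have := (hasDerivAt_coordLine_apply y l j).fun_mul ((hs.sq.dY hW j).hasDerivAt_dY hW hxy l)
      simpa using this
  simp only [Finset.sum_add_distrib, ite_mul, one_mul, zero_mul, Finset.sum_ite_eq',
    Finset.mem_univ, if_true] at h1
  have h2 := dY_sq hs hW hxy l
  simp only [fundTensor, Matrix.of_apply]
  have : ∑ j, 1 / 2 * dY l (dY j fun x y => F x y ^ 2) x y * y j
      = 1 / 2 * ∑ j, y j * dY l (dY j fun x y => F x y ^ 2) x y := by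
    rw [Finset.mul_sum]
    exact Finset.sum_congr rfl fun j _ => by ring
  rw [this]
  linarith

/-- The geodesic coefficients differ from `P yⁱ` by the Hamel tensor, with its index raised. -/
lemma IsFinslerOn.spray_eq (hF : IsFinslerOn U F) (hU : IsOpen U) (hx : x ∈ U) (hy : y ≠ 0)
    (i : Fin n) :
    spray F x y i = projFactor F x y * y i
      + F x y / 2 * ∑ l, (fundTensor F x y)⁻¹ i l * hamel F x y l := by
  have hW := isOpen_slit hU
  have hs := hF.smoothOn
  have hxy : (x, y) ∈ U ×ˢ ({0}ᶜ : Set (Fin n → ℝ)) := ⟨hx, hy⟩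
  have hg := hF.convex x hx y hy
  have hpos := (hF.pos x hx y hy).ne'
  have hyi : ∑ l, (fundTensor F x y)⁻¹ i l * (F x y * dY l F x y) = y i := by
    have h1 : (fun l => F x y * dY l F x y) = (fundTensor F x y) *ᵥ y := by
      ext l
      rw [← hF.sum_fundTensor hU hx hy l, Matrix.mulVec, dotProduct]
      refine Finset.sum_congr rfl fun j _ => ?_
      have := hg.isHermitian.apply j l
      simp only [star_trivial] at this
      rw [this]
    have h2 : (fundTensor F x y)⁻¹ *ᵥ (fun l => F x y * dY l F x y) = y := by
      rw [h1, Matrix.mulVec_mulVec, Matrix.nonsing_inv_mul _ hg.det_pos.ne'.isUnit,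
        Matrix.one_mulVec]
    exact congrFun h2 i
  have hterm : ∀ l, (∑ m, dY l (dX m (fun x y => F x y ^ 2)) x y * y m)
      - dX l (fun x y => F x y ^ 2) x y
      = 2 * (dY l F x y * ∑ k, dX k F x y * y k) + 2 * (F x y * hamel F x y l) := by
    intro l
    simp only [dY_dX_sq hs hW hxy, dX_sq hs hW hxy, hamel, mul_sub, Finset.mul_sum]
    rw [add_sub, ← Finset.sum_add_distrib]
    congr 1
    · exact Finset.sum_congr rfl fun m _ => by ring
    · ring
  simp only [spray, hterm, projFactor]
  generalize (∑ k, dX k F x y * y k) = D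
  have hsum : ∑ l, (fundTensor F x y)⁻¹ i l * (2 * (dY l F x y * D) + 2 * (F x y * hamel F x y l))
      = 2 * D / F x y * ∑ l, (fundTensor F x y)⁻¹ i l * (F x y * dY l F x y)
        + 2 * F x y * ∑ l, (fundTensor F x y)⁻¹ i l * hamel F x y l := by
    rw [Finset.mul_sum, Finset.mul_sum, ← Finset.sum_add_distrib]
    exact Finset.sum_congr rfl fun l _ => by field_simp
  rw [hsum, hyi]
  field_simp
  ring

/-- Hamel's criterion, pointwise in `(x, y)`. -/
lemma IsFinslerOn.spray_eq_iff (hF : IsFinslerOn U F) (hU : IsOpen U) (hx : x ∈ U) (hy : y ≠ 0) :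
    (∀ i, spray F x y i = projFactor F x y * y i) ↔ ∀ l, hamel F x y l = 0 := by
  have hg := hF.convex x hx y hy
  have hpos := (hF.pos x hx y hy).ne'
  constructor
  · intro h
    have h1 : (fundTensor F x y)⁻¹ *ᵥ hamel F x y = 0 := by
      ext i
      have := hF.spray_eq hU hx hy i
      rw [h i] at this
      simpa [hpos, Matrix.mulVec, dotProduct] using this
    have h2 : (fundTensor F x y) *ᵥ ((fundTensor F x y)⁻¹ *ᵥ hamel F x y) = hamel F x y := by
      rw [Matrix.mulVec_mulVec, Matrix.mul_nonsing_inv _ hg.det_pos.ne'.isUnit, Matrix.one_mulVec]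
    rw [h1, Matrix.mulVec_zero] at h2
    exact fun l => (congrFun h2 l).symm
  · intro h i
    rw [hF.spray_eq hU hx hy i]
    simp [h]

end Hamel


/-! ### The Riemannian metric `α` -/

section Riemannian

variable {n : ℕ} {U : Set (Fin n → ℝ)} {a : (Fin n → ℝ) → Matrix (Fin n) (Fin n) ℝ}
  {b : (Fin n → ℝ) → Fin n → ℝ} {x y : Fin n → ℝ}

/-- The quadratic form `α² = a_{ij}(x) yⁱ yʲ`. -/
def quad (a : (Fin n → ℝ) → Matrix (Fin n) (Fin n) ℝ) (x y : Fin n → ℝ) : ℝ :=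
  ∑ i, ∑ j, a x i j * y i * y j

/-- The vector field `bⁱ = a^{ij} b_j` dual to `β`. -/
def sharp (a : (Fin n → ℝ) → Matrix (Fin n) (Fin n) ℝ) (b : (Fin n → ℝ) → Fin n → ℝ)
    (x : Fin n → ℝ) : Fin n → ℝ := (a x)⁻¹ *ᵥ b x

lemma smoothOn_of_left {f : (Fin n → ℝ) → ℝ} (hf : ContDiffOn ℝ ∞ f U) (T : Set (Fin n → ℝ)) :
    SmoothOn (U ×ˢ T) (fun x _ => f x) :=
  hf.comp contDiffOn_fst fun _ h => h.1

lemma smoothOn_coord (W : Set ((Fin n → ℝ) × (Fin n → ℝ))) (i : Fin n) :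
    SmoothOn W (fun _ y => y i) :=
  ((contDiff_apply ℝ ℝ i).comp contDiff_snd).contDiffOn

lemma ContDiffOn.pd {f : (Fin n → ℝ) → ℝ} (hf : ContDiffOn ℝ ∞ f U) (hU : IsOpen U) (i : Fin n) :
    ContDiffOn ℝ ∞ (fun x => pd i f x) U :=
  (hf.fderiv_of_isOpen hU (m := ∞) (by simp)).clm_apply contDiffOn_const

lemma hasDerivAt_pd {f : (Fin n → ℝ) → ℝ} (hf : ContDiffOn ℝ ∞ f U) (hU : IsOpen U) (hx : x ∈ U)
    (i : Fin n) : HasDerivAt (fun r => f (coordLine x i r)) (GenAlphaBeta.pd i f x) 0 :=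
  hasDerivAt_comp_coordLine ((hf.contDiffAt (hU.mem_nhds hx)).differentiableAt (by simp)) i

lemma pd_congr {f g : (Fin n → ℝ) → ℝ} (hU : IsOpen U) (hx : x ∈ U) (h : ∀ z ∈ U, f z = g z)
    (i : Fin n) : pd i f x = pd i g x := by
  have : f =ᶠ[nhds x] g := by
    filter_upwards [hU.mem_nhds hx] with z hz using h z hz
  simp only [pd, this.fderiv_eq]

lemma pd_eq_of_hasDerivAt {f g : (Fin n → ℝ) → ℝ} (hf : ContDiffOn ℝ ∞ f U) (hU : IsOpen U)
    (hx : x ∈ U) {i : Fin n} {d : ℝ} (hfg : ∀ z ∈ U, f z = g z)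
    (hd : HasDerivAt (fun r => g (coordLine x i r)) d 0) : pd i f x = d := by
  have hc := (continuous_coordLine x i).continuousAt (x := 0)
  refine (hasDerivAt_pd hf hU hx i).unique (hd.congr_of_eventuallyEq ?_)
  filter_upwards [hc.eventually_mem (hU.mem_nhds (by simpa using hx))] with r hr using hfg _ hr

lemma smoothOn_quad (ha : IsRiemannianOn U a) (T : Set (Fin n → ℝ)) :
    SmoothOn (U ×ˢ T) (quad a) :=
  ContDiffOn.sum fun i _ => ContDiffOn.sum fun j _ =>
    (ContDiffOn.mul (ContDiffOn.mul (smoothOn_of_left (ha.1 i j) T) (smoothOn_coord _ i))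
      (smoothOn_coord _ j))

lemma IsRiemannianOn.symm (ha : IsRiemannianOn U a) (hx : x ∈ U) (i j : Fin n) :
    a x i j = a x j i := by
  simpa using ((ha.2 x hx).isHermitian.apply i j).symm

lemma toBilin'_self (x y : Fin n → ℝ) : Matrix.toBilin' (a x) y y = quad a x y := by
  rw [Matrix.toBilin'_apply, quad]
  exact Finset.sum_congr rfl fun i _ => Finset.sum_congr rfl fun j _ => by ring

lemma IsRiemannianOn.bilin_symm (ha : IsRiemannianOn U a) (hx : x ∈ U) (y z : Fin n → ℝ) :
    Matrix.toBilin' (a x) y z = Matrix.toBilin' (a x) z y := by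
  rw [Matrix.toBilin'_apply, Matrix.toBilin'_apply, Finset.sum_comm]
  refine Finset.sum_congr rfl fun i _ => Finset.sum_congr rfl fun j _ => ?_
  rw [ha.symm hx]
  ring

lemma IsRiemannianOn.bilin_pos (ha : IsRiemannianOn U a) (hx : x ∈ U) (y : Fin n → ℝ)
    (hy : y ≠ 0) : 0 < Matrix.toBilin' (a x) y y := by
  simpa [Matrix.toBilin'_apply'] using (ha.2 x hx).dotProduct_mulVec_pos hy

lemma IsRiemannianOn.quad_pos (ha : IsRiemannianOn U a) (hx : x ∈ U) (hy : y ≠ 0) :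
    0 < quad a x y := by
  rw [← toBilin'_self]; exact ha.bilin_pos hx y hy

lemma IsRiemannianOn.alpha_pos (ha : IsRiemannianOn U a) (hx : x ∈ U) (hy : y ≠ 0) :
    0 < alpha a x y := Real.sqrt_pos.2 (ha.quad_pos hx hy)

lemma IsRiemannianOn.alpha_sq (ha : IsRiemannianOn U a) (hx : x ∈ U) (y : Fin n → ℝ) :
    alpha a x y ^ 2 = quad a x y := by
  rcases eq_or_ne y 0 with rfl | hy
  · simp [alpha, quad]
  · exact Real.sq_sqrt (ha.quad_pos hx hy).le

lemma smoothOn_alpha (ha : IsRiemannianOn U a) :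
    SmoothOn (U ×ˢ ({0}ᶜ : Set (Fin n → ℝ))) (alpha a) :=
  ContDiffOn.sqrt (smoothOn_quad ha _) fun _ h => (ha.quad_pos h.1 h.2).ne'

lemma smoothOn_beta (hb : ∀ i, ContDiffOn ℝ ∞ (fun x => b x i) U) (T : Set (Fin n → ℝ)) :
    SmoothOn (U ×ˢ T) (beta b) :=
  ContDiffOn.sum fun i _ => ContDiffOn.mul (smoothOn_of_left (hb i) T) (smoothOn_coord _ i)

lemma dX_quad (ha : IsRiemannianOn U a) (hU : IsOpen U) (hx : x ∈ U) (y : Fin n → ℝ)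
    (m : Fin n) : dX m (quad a) x y = ∑ i, ∑ j, pd m (fun z => a z i j) x * y i * y j := by
  refine (smoothOn_quad ha Set.univ).dX_eq (hU.prod isOpen_univ) ⟨hx, trivial⟩
    (fun _ _ _ => rfl) ?_
  exact HasDerivAt.fun_sum fun i _ => HasDerivAt.fun_sum fun j _ =>
    ((hasDerivAt_pd (ha.1 i j) hU hx m).mul_const _).mul_const _

lemma hasDerivAt_quadratic (M : Matrix (Fin n) (Fin n) ℝ) (hM : ∀ i j, M i j = M j i)
    (y : Fin n → ℝ) (l : Fin n) :
    HasDerivAt (fun r => ∑ i, ∑ j, M i j * coordLine y l r i * coordLine y l r j)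
      (2 * ∑ j, M l j * y j) 0 := by
  have h : HasDerivAt (fun r => ∑ i, ∑ j, M i j * coordLine y l r i * coordLine y l r j)
      (∑ i, ∑ j, (M i j * (if i = l then 1 else 0) * y j
        + M i j * y i * (if j = l then 1 else 0))) 0 := by
    refine HasDerivAt.fun_sum fun i _ => HasDerivAt.fun_sum fun j _ => ?_
    simpa using ((hasDerivAt_coordLine_apply y l i).const_mul (M i j)).fun_mul
      (hasDerivAt_coordLine_apply y l j)
  convert h using 1
  simp only [Finset.sum_add_distrib, mul_ite, mul_one, mul_zero, ite_mul, zero_mul,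
    Finset.sum_ite_eq', Finset.mem_univ, if_true]
  rw [Finset.sum_comm]
  simp only [Finset.sum_ite_eq', Finset.mem_univ, if_true]
  rw [two_mul]
  congr 1
  exact Finset.sum_congr rfl fun j _ => by rw [hM]

lemma dY_quad (ha : IsRiemannianOn U a) (hU : IsOpen U) (hx : x ∈ U) (y : Fin n → ℝ)
    (l : Fin n) : dY l (quad a) x y = 2 * ∑ j, a x l j * y j :=
  (smoothOn_quad ha Set.univ).dY_eq (hU.prod isOpen_univ) ⟨hx, trivial⟩
    (fun _ _ => rfl) (hasDerivAt_quadratic (a x) (ha.symm hx) y l)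

lemma dY_dY_quad (ha : IsRiemannianOn U a) (hU : IsOpen U) (hx : x ∈ U) (y : Fin n → ℝ)
    (l m : Fin n) : dY m (dY l (quad a)) x y = 2 * a x l m := by
  have hW := hU.prod (isOpen_univ (X := Fin n → ℝ))
  refine ((smoothOn_quad ha Set.univ).dY hW l).dY_eq hW ⟨hx, trivial⟩
    (g := fun x y => 2 * ∑ j, a x l j * y j) (fun y _ => dY_quad ha hU hx y l) ?_
  have h : HasDerivAt (fun r => 2 * ∑ j, a x l j * coordLine y m r j)
      (2 * ∑ j, a x l j * (if j = m then 1 else 0)) 0 :=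
    HasDerivAt.const_mul _ (HasDerivAt.fun_sum fun j _ =>
      (hasDerivAt_coordLine_apply y m j).const_mul _)
  simpa using h

lemma IsRiemannianOn.pd_symm (ha : IsRiemannianOn U a) (hU : IsOpen U) (hx : x ∈ U)
    (m i j : Fin n) : pd m (fun z => a z i j) x = pd m (fun z => a z j i) x :=
  pd_congr hU hx (fun _ hz => ha.symm hz i j) m

lemma dY_dX_quad (ha : IsRiemannianOn U a) (hU : IsOpen U) (hx : x ∈ U) (y : Fin n → ℝ)
    (l m : Fin n) : dY l (dX m (quad a)) x y = 2 * ∑ j, pd m (fun z => a z l j) x * y j := by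
  have hW := hU.prod (isOpen_univ (X := Fin n → ℝ))
  exact ((smoothOn_quad ha Set.univ).dX hW m).dY_eq hW ⟨hx, trivial⟩
    (g := fun x y => ∑ i, ∑ j, pd m (fun z => a z i j) x * y i * y j)
    (fun y _ => dX_quad ha hU hx y m)
    (hasDerivAt_quadratic (fun i j => pd m (fun z => a z i j) x) (ha.pd_symm hU hx m) y l)

lemma alpha_sq_eq_quad (ha : IsRiemannianOn U a) :
    ∀ x y, (x, y) ∈ U ×ˢ (Set.univ : Set (Fin n → ℝ)) → alpha a x y ^ 2 = quad a x y :=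
  fun _ y h => ha.alpha_sq h.1 y

/-- The fundamental tensor of `α` is `a`. -/
lemma fundTensor_alpha (ha : IsRiemannianOn U a) (hU : IsOpen U) (hx : x ∈ U) (y : Fin n → ℝ) :
    fundTensor (alpha a) x y = a x := by
  have hW := hU.prod (isOpen_univ (X := Fin n → ℝ))
  ext i j
  rw [fundTensor, Matrix.of_apply,
    dY_congr hW ⟨hx, trivial⟩ (fun x y h => dY_congr hW h (alpha_sq_eq_quad ha) i) j,
    dY_dY_quad ha hU hx]
  ring

lemma alpha_smul {r : ℝ} (hr : 0 < r) (x y : Fin n → ℝ) :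
    alpha a x (r • y) = r * alpha a x y := by
  have : ∑ i, ∑ j, a x i j * (r • y) i * (r • y) j = r ^ 2 * ∑ i, ∑ j, a x i j * y i * y j := by
    simp only [Finset.mul_sum, Pi.smul_apply, smul_eq_mul]
    exact Finset.sum_congr rfl fun i _ => Finset.sum_congr rfl fun j _ => by ring
  rw [alpha, this, Real.sqrt_mul (by positivity), Real.sqrt_sq hr.le, alpha]

/-- A Riemannian metric is a Finsler metric. -/
lemma IsRiemannianOn.isFinslerOn (ha : IsRiemannianOn U a) (hU : IsOpen U) :
    IsFinslerOn U (alpha a) where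
  smooth := smoothOn_alpha ha
  pos _ hx _ hy := ha.alpha_pos hx hy
  homogeneous x _ y _ hr := alpha_smul hr x y
  convex x hx y _ := by rw [fundTensor_alpha ha hU hx y]; exact ha.2 x hx

/-- The geodesic coefficients of `α` are `½ Γⁱ_{jk} yʲ yᵏ`. -/
lemma spray_alpha (ha : IsRiemannianOn U a) (hU : IsOpen U) (hx : x ∈ U) (y : Fin n → ℝ)
    (m : Fin n) :
    2 * spray (alpha a) x y m = ∑ i, ∑ j, christoffel a x m i j * y i * y j := by
  have hW := hU.prod (isOpen_univ (X := Fin n → ℝ))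
  have h1 : ∀ l k, dY l (dX k (fun x y => alpha a x y ^ 2)) x y
      = 2 * ∑ j, pd k (fun z => a z l j) x * y j := fun l k => by
    rw [dY_congr hW ⟨hx, trivial⟩ (fun x y h => dX_congr hW h (alpha_sq_eq_quad ha) k) l,
      dY_dX_quad ha hU hx]
  have h2 : ∀ l, dX l (fun x y => alpha a x y ^ 2) x y
      = ∑ i, ∑ j, pd l (fun z => a z i j) x * y i * y j := fun l => by
    rw [dX_congr hW ⟨hx, trivial⟩ (alpha_sq_eq_quad ha), dX_quad ha hU hx]
  simp only [spray, fundTensor_alpha ha hU hx, h1, h2, christoffel]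
  have h3 : ∀ l, (∑ k, (2 * ∑ j, pd k (fun z => a z l j) x * y j) * y k)
      - ∑ i, ∑ j, pd l (fun z => a z i j) x * y i * y j
      = ∑ i, ∑ j, (pd i (fun z => a z l j) x + pd j (fun z => a z l i) x
        - pd l (fun z => a z i j) x) * y i * y j := by
    intro l
    simp only [add_mul, sub_mul, Finset.sum_add_distrib, Finset.sum_sub_distrib]
    congr 1
    have e1 : ∑ i, ∑ j, pd j (fun z => a z l i) x * y i * y j
        = ∑ i, ∑ j, pd i (fun z => a z l j) x * y i * y j := by
      rw [Finset.sum_comm]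
      exact Finset.sum_congr rfl fun i _ => Finset.sum_congr rfl fun j _ => by ring
    rw [e1, ← two_mul, Finset.mul_sum]
    refine Finset.sum_congr rfl fun k _ => ?_
    rw [mul_assoc, Finset.sum_mul]
    exact congrArg _ (Finset.sum_congr rfl fun j _ => by ring)
  simp only [h3]
  simp only [Finset.mul_sum, Finset.sum_mul]
  rw [Finset.sum_comm]
  refine Finset.sum_congr rfl fun i _ => ?_
  rw [Finset.sum_comm]
  exact Finset.sum_congr rfl fun j _ => Finset.sum_congr rfl fun l _ => by ring

/-! ### Covariant derivative of the one-form -/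

lemma christoffel_symm (ha : IsRiemannianOn U a) (hU : IsOpen U) (hx : x ∈ U) (m i j : Fin n) :
    christoffel a x m i j = christoffel a x m j i := by
  simp only [christoffel]
  congr 1
  refine Finset.sum_congr rfl fun l _ => ?_
  rw [ha.pd_symm hU hx l i j]
  ring

/-- The antisymmetric part of the covariant derivative is the exterior derivative. -/
lemma covDeriv_sub (ha : IsRiemannianOn U a) (hU : IsOpen U) (hx : x ∈ U) (i j : Fin n) :
    covDeriv a b x i j - covDeriv a b x j i
      = pd j (fun z => b z i) x - pd i (fun z => b z j) x := by
  simp only [covDeriv, christoffel_symm ha hU hx _ j i]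
  ring

/-- `b_{i|j} yⁱ yʲ = (∂_j b_i) yⁱ yʲ - 2 b_m Gᵐ`. -/
lemma covDeriv_quadratic (ha : IsRiemannianOn U a) (hU : IsOpen U) (hx : x ∈ U)
    (y : Fin n → ℝ) :
    Matrix.toBilin' (Matrix.of (covDeriv a b x)) y y
      = (∑ i, ∑ j, pd j (fun z => b z i) x * y i * y j)
        - 2 * ∑ m, b x m * spray (alpha a) x y m := by
  have h : 2 * ∑ m, b x m * spray (alpha a) x y m
      = ∑ i, ∑ j, (∑ m, christoffel a x m i j * b x m) * y i * y j := by
    simp only [Finset.mul_sum, Finset.sum_mul]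
    have : ∀ m, 2 * (b x m * spray (alpha a) x y m)
        = ∑ i, ∑ j, christoffel a x m i j * b x m * y i * y j := by
      intro m
      rw [mul_left_comm, spray_alpha ha hU hx]
      simp only [Finset.mul_sum]
      exact Finset.sum_congr rfl fun i _ => Finset.sum_congr rfl fun j _ => by ring
    simp only [this]
    rw [Finset.sum_comm]
    refine Finset.sum_congr rfl fun i _ => ?_
    rw [Finset.sum_comm]
  rw [h, Matrix.toBilin'_apply]
  simp only [← Finset.sum_sub_distrib, covDeriv, Matrix.of_apply]
  exact Finset.sum_congr rfl fun i _ => Finset.sum_congr rfl fun j _ => by ring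

lemma contDiffOn_det {M : (Fin n → ℝ) → Matrix (Fin n) (Fin n) ℝ}
    (hM : ∀ i j, ContDiffOn ℝ ∞ (fun x => M x i j) U) :
    ContDiffOn ℝ ∞ (fun x => (M x).det) U := by
  simp only [Matrix.det_apply']
  exact ContDiffOn.sum fun σ _ => contDiffOn_const.mul (contDiffOn_prod fun i _ => hM _ _)

/-- The inverse metric `a^{ij}` is smooth. -/
lemma IsRiemannianOn.contDiffOn_inv (ha : IsRiemannianOn U a) (i j : Fin n) :
    ContDiffOn ℝ ∞ (fun x => (a x)⁻¹ i j) U := by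
  have h1 : ContDiffOn ℝ ∞ (fun x => ((a x).updateRow j (Pi.single i 1)).det) U := by
    refine contDiffOn_det fun k l => ?_
    rcases eq_or_ne k j with rfl | hk
    · simpa using contDiffOn_const
    · simpa [Matrix.updateRow_ne hk] using ha.1 k l
  refine ((contDiffOn_det ha.1).inv fun x hx => (ha.2 x hx).det_pos.ne').mul h1 |>.congr ?_
  intro x hx
  simp [Matrix.inv_def, Matrix.adjugate_apply]

lemma contDiffOn_sharp (ha : IsRiemannianOn U a) (hb : ∀ i, ContDiffOn ℝ ∞ (fun x => b x i) U)
    (i : Fin n) : ContDiffOn ℝ ∞ (fun x => sharp a b x i) U :=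
  ContDiffOn.sum (f := fun j x => (a x)⁻¹ i j * b x j) (s := Finset.univ)
    fun j _ => (ha.contDiffOn_inv i j).mul (hb j)

lemma IsRiemannianOn.mulVec_sharp (ha : IsRiemannianOn U a) (hx : x ∈ U) :
    a x *ᵥ sharp a b x = b x := by
  rw [sharp, Matrix.mulVec_mulVec, Matrix.mul_nonsing_inv _ (ha.2 x hx).det_pos.ne'.isUnit,
    Matrix.one_mulVec]

lemma normSq_eq (x : Fin n → ℝ) : normSq a b x = ∑ i, sharp a b x i * b x i := by
  simp only [normSq, sharp, Matrix.mulVec, dotProduct, Finset.sum_mul]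
  exact Finset.sum_congr rfl fun i _ => Finset.sum_congr rfl fun j _ => by ring

lemma contDiffOn_normSq (ha : IsRiemannianOn U a)
    (hb : ∀ i, ContDiffOn ℝ ∞ (fun x => b x i) U) : ContDiffOn ℝ ∞ (normSq a b) U :=
  (ContDiffOn.sum fun i _ => (contDiffOn_sharp ha hb i).mul (hb i)).congr fun x _ => normSq_eq x

lemma IsRiemannianOn.bilin_sharp (ha : IsRiemannianOn U a) (hx : x ∈ U) (y : Fin n → ℝ) :
    Matrix.toBilin' (a x) (sharp a b x) y = beta b x y := by
  rw [ha.bilin_symm hx, Matrix.toBilin'_apply', ha.mulVec_sharp hx, dotProduct_comm]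
  rfl

lemma IsRiemannianOn.bilin_sharp_self (ha : IsRiemannianOn U a) (hx : x ∈ U) :
    Matrix.toBilin' (a x) (sharp a b x) (sharp a b x) = normSq a b x := by
  rw [ha.bilin_sharp hx, normSq_eq]
  exact Finset.sum_congr rfl fun i _ => mul_comm _ _

lemma IsRiemannianOn.sharp_ne_zero (ha : IsRiemannianOn U a) (hx : x ∈ U) (h : b x ≠ 0) :
    sharp a b x ≠ 0 := by
  intro h0
  apply h
  rw [← ha.mulVec_sharp (b := b) hx, h0, Matrix.mulVec_zero]

lemma IsRiemannianOn.normSq_pos (ha : IsRiemannianOn U a) (hx : x ∈ U) (h : b x ≠ 0) :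
    0 < normSq a b x := by
  rw [← ha.bilin_sharp_self hx]
  exact ha.bilin_pos hx _ (ha.sharp_ne_zero hx h)

/-- `b_m Γᵐ_{ik} = ½ bˡ (∂_i a_{lk} + ∂_k a_{li} - ∂_l a_{ik})`. -/
lemma sum_christoffel_mul (ha : IsRiemannianOn U a) (hx : x ∈ U) (i k : Fin n) :
    ∑ m, christoffel a x m i k * b x m
      = (1 / 2) * ∑ l, sharp a b x l * (pd i (fun z => a z l k) x + pd k (fun z => a z l i) x
        - pd l (fun z => a z i k) x) := by
  simp only [christoffel, sharp, Matrix.mulVec, dotProduct, Finset.mul_sum, Finset.sum_mul]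
  rw [Finset.sum_comm]
  refine Finset.sum_congr rfl fun l _ => Finset.sum_congr rfl fun m _ => ?_
  have := (ha.2 x hx).inv.isHermitian.apply l m
  simp only [star_trivial] at this
  rw [← this]
  ring

/-- Compatibility with the metric: `∂_k b² = 2 bⁱ b_{i|k}`. -/
lemma pd_normSq (ha : IsRiemannianOn U a) (hb : ∀ i, ContDiffOn ℝ ∞ (fun x => b x i) U)
    (hU : IsOpen U) (hx : x ∈ U) (k : Fin n) :
    pd k (normSq a b) x = 2 * ∑ i, sharp a b x i * covDeriv a b x i k := by
  set u := sharp a b x with hu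
  set u' := fun i => pd k (fun z => sharp a b z i) x with hu'
  set b' := fun i => pd k (fun z => b z i) x with hb'
  set a' := fun i j => pd k (fun z => a z i j) x with ha'
  have hbx : ∀ i, b x i = ∑ j, a x i j * u j := fun i => by
    rw [← congrFun (ha.mulVec_sharp (b := b) hx) i]; rfl
  have h1 : pd k (normSq a b) x = ∑ i, (u' i * b x i + u i * b' i) := by
    refine pd_eq_of_hasDerivAt (contDiffOn_normSq ha hb) hU hx (fun z _ => normSq_eq z) ?_
    refine HasDerivAt.fun_sum fun i _ => ?_
    simpa using (hasDerivAt_pd (contDiffOn_sharp ha hb i) hU hx k).fun_mul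
      (hasDerivAt_pd (hb i) hU hx k)
  have h2 : ∀ i, b' i = ∑ j, (a' i j * u j + a x i j * u' j) := fun i => by
    refine pd_eq_of_hasDerivAt (g := fun z => ∑ j, a z i j * sharp a b z j) (hb i) hU hx
      (fun z hz => by rw [← congrFun (ha.mulVec_sharp (b := b) hz) i]; rfl) ?_
    refine HasDerivAt.fun_sum fun j _ => ?_
    simpa using (hasDerivAt_pd (ha.1 i j) hU hx k).fun_mul
      (hasDerivAt_pd (contDiffOn_sharp ha hb j) hU hx k)
  have h3 : ∑ i, u i * b' i = (∑ i, ∑ j, u i * u j * a' i j) + ∑ i, u' i * b x i := by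
    simp only [h2, hbx, Finset.mul_sum, mul_add, Finset.sum_add_distrib]
    congr 1
    · exact Finset.sum_congr rfl fun i _ => Finset.sum_congr rfl fun j _ => by ring
    · rw [Finset.sum_comm]
      refine Finset.sum_congr rfl fun i _ => Finset.sum_congr rfl fun j _ => ?_
      rw [ha.symm hx]
      ring
  have h4 : ∑ i, u i * ∑ m, christoffel a x m i k * b x m
      = (1 / 2) * ∑ i, ∑ j, u i * u j * a' i j := by
    simp only [sum_christoffel_mul ha hx, ← hu]
    have e1 : ∑ i, ∑ l, u i * u l * pd i (fun z => a z l k) x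
        = ∑ i, ∑ l, u i * u l * pd l (fun z => a z i k) x := by
      rw [Finset.sum_comm]
      exact Finset.sum_congr rfl fun i _ => Finset.sum_congr rfl fun j _ => by ring
    have e2 : ∑ i, ∑ l, u i * u l * pd k (fun z => a z l i) x
        = ∑ i, ∑ j, u i * u j * a' i j :=
      Finset.sum_congr rfl fun i _ => Finset.sum_congr rfl fun j _ => by
        rw [ha.pd_symm hU hx k j i]
    calc ∑ i, u i * (1 / 2 * ∑ l, u l * (pd i (fun z => a z l k) x + pd k (fun z => a z l i) x
        - pd l (fun z => a z i k) x))
        = (1 / 2) * (∑ i, ∑ l, u i * u l * pd i (fun z => a z l k) x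
          + ∑ i, ∑ l, u i * u l * pd k (fun z => a z l i) x
          - ∑ i, ∑ l, u i * u l * pd l (fun z => a z i k) x) := by
          simp only [Finset.mul_sum, ← Finset.sum_add_distrib, ← Finset.sum_sub_distrib]
          exact Finset.sum_congr rfl fun i _ => Finset.sum_congr rfl fun j _ => by ring
      _ = _ := by rw [e1, e2]; ring
  simp only [covDeriv, mul_sub, Finset.sum_sub_distrib, h4]
  rw [h1, Finset.sum_add_distrib]
  simp only [hb'] at h3 ⊢
  rw [h3]
  ring

/-- `b_{i|j}` is smooth. -/
lemma contDiffOn_covDeriv (ha : IsRiemannianOn U a)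
    (hb : ∀ i, ContDiffOn ℝ ∞ (fun x => b x i) U) (hU : IsOpen U) (i j : Fin n) :
    ContDiffOn ℝ ∞ (fun x => covDeriv a b x i j) U := by
  refine (ContDiffOn.pd (hb i) hU j).sub (ContDiffOn.sum fun m _ => ContDiffOn.mul ?_ (hb m))
  refine contDiffOn_const.mul (ContDiffOn.sum fun l _ => (ha.contDiffOn_inv m l).mul ?_)
  exact ((ContDiffOn.pd (ha.1 _ _) hU _).add (ContDiffOn.pd (ha.1 _ _) hU _)).sub
    (ContDiffOn.pd (ha.1 _ _) hU _)

end Riemannian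


/-! ### The Hamel tensor of a general `(α, β)`-metric -/

section GeneralMetric

variable {n : ℕ} {U : Set (Fin n → ℝ)} {a : (Fin n → ℝ) → Matrix (Fin n) (Fin n) ℝ}
  {b : (Fin n → ℝ) → Fin n → ℝ} {x y : Fin n → ℝ} {φ : ℝ → ℝ → ℝ} {Ω : Set (ℝ × ℝ)} {t s : ℝ}

lemma hasFDerivAt_phi (hΩ : IsOpen Ω) (hφ : ContDiffOn ℝ ∞ (fun p : ℝ × ℝ => φ p.1 p.2) Ω)
    (h : (t, s) ∈ Ω) : HasFDerivAt (fun p : ℝ × ℝ => φ p.1 p.2)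
      (fderiv ℝ (fun p : ℝ × ℝ => φ p.1 p.2) (t, s)) (t, s) :=
  ((hφ.contDiffAt (hΩ.mem_nhds h)).differentiableAt (by simp)).hasFDerivAt

lemma d1_eq_fderiv (hΩ : IsOpen Ω) (hφ : ContDiffOn ℝ ∞ (fun p : ℝ × ℝ => φ p.1 p.2) Ω)
    (h : (t, s) ∈ Ω) :
    d1 φ t s = fderiv ℝ (fun p : ℝ × ℝ => φ p.1 p.2) (t, s) (1, 0) := by
  have h1 : HasDerivAt (fun t' : ℝ => (t', s)) ((1 : ℝ), (0 : ℝ)) t :=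
    (hasDerivAt_id t).prodMk (hasDerivAt_const t s)
  exact ((hasFDerivAt_phi hΩ hφ h).comp_hasDerivAt t h1).deriv

lemma d2_eq_fderiv (hΩ : IsOpen Ω) (hφ : ContDiffOn ℝ ∞ (fun p : ℝ × ℝ => φ p.1 p.2) Ω)
    (h : (t, s) ∈ Ω) :
    d2 φ t s = fderiv ℝ (fun p : ℝ × ℝ => φ p.1 p.2) (t, s) (0, 1) := by
  have h1 : HasDerivAt (fun s' : ℝ => (t, s')) ((0 : ℝ), (1 : ℝ)) s :=
    (hasDerivAt_const s t).prodMk (hasDerivAt_id s)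
  exact ((hasFDerivAt_phi hΩ hφ h).comp_hasDerivAt s h1).deriv

lemma contDiffOn_d1 (hΩ : IsOpen Ω) (hφ : ContDiffOn ℝ ∞ (fun p : ℝ × ℝ => φ p.1 p.2) Ω) :
    ContDiffOn ℝ ∞ (fun p : ℝ × ℝ => d1 φ p.1 p.2) Ω :=
  ((hφ.fderiv_of_isOpen hΩ (m := ∞) (by simp)).clm_apply
    (contDiffOn_const (c := ((1 : ℝ), (0 : ℝ))))).congr fun _ h => d1_eq_fderiv hΩ hφ h

lemma contDiffOn_d2 (hΩ : IsOpen Ω) (hφ : ContDiffOn ℝ ∞ (fun p : ℝ × ℝ => φ p.1 p.2) Ω) :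
    ContDiffOn ℝ ∞ (fun p : ℝ × ℝ => d2 φ p.1 p.2) Ω :=
  ((hφ.fderiv_of_isOpen hΩ (m := ∞) (by simp)).clm_apply
    (contDiffOn_const (c := ((0 : ℝ), (1 : ℝ))))).congr fun _ h => d2_eq_fderiv hΩ hφ h

/-- The chain rule for `φ(t(r), s(r))`. -/
lemma hasDerivAt_phi_comp (hΩ : IsOpen Ω) (hφ : ContDiffOn ℝ ∞ (fun p : ℝ × ℝ => φ p.1 p.2) Ω)
    {u v : ℝ → ℝ} {u' v' : ℝ} (hu : HasDerivAt u u' 0) (hv : HasDerivAt v v' 0)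
    (h : (u 0, v 0) ∈ Ω) :
    HasDerivAt (fun r => φ (u r) (v r)) (d1 φ (u 0) (v 0) * u' + d2 φ (u 0) (v 0) * v') 0 := by
  have h1 := (hasFDerivAt_phi hΩ hφ h).comp_hasDerivAt (f := fun r => (u r, v r)) 0 (hu.prodMk hv)
  have h2 : (u', v') = u' • ((1 : ℝ), (0 : ℝ)) + v' • ((0 : ℝ), (1 : ℝ)) := by simp
  rw [h2, map_add, map_smul, map_smul, ← d1_eq_fderiv hΩ hφ h, ← d2_eq_fderiv hΩ hφ h] at h1
  simpa [mul_comm, Function.comp_def] using h1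

/-- The chain rule for `φ(t, s(r))`. -/
lemma hasDerivAt_phi_comp_right (hΩ : IsOpen Ω)
    (hφ : ContDiffOn ℝ ∞ (fun p : ℝ × ℝ => φ p.1 p.2) Ω)
    {v : ℝ → ℝ} {v' : ℝ} (hv : HasDerivAt v v' 0) (h : (t, v 0) ∈ Ω) :
    HasDerivAt (fun r => φ t (v r)) (d2 φ t (v 0) * v') 0 := by
  simpa using hasDerivAt_phi_comp hΩ hφ (hasDerivAt_const 0 t) hv h

/-- Cauchy–Schwarz: `β² ≤ b² α²`. -/
lemma IsRiemannianOn.beta_sq_le (ha : IsRiemannianOn U a) (hx : x ∈ U) (y : Fin n → ℝ) :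
    beta b x y ^ 2 ≤ normSq a b x * quad a x y := by
  rcases eq_or_ne (sharp a b x) 0 with h | h
  · have h1 := ha.bilin_sharp (b := b) hx y
    have h2 := ha.bilin_sharp_self (b := b) hx
    simp only [h, map_zero, LinearMap.zero_apply] at h1 h2
    rw [← h1, ← h2]
    simp
  · have hpos := ha.bilin_pos hx
    obtain ⟨w, hw, hy⟩ := quadratic_decomp hpos h y
    have hww : 0 ≤ Matrix.toBilin' (a x) w w := by
      rcases eq_or_ne w 0 with rfl | hw0
      · simp
      · exact (hpos w hw0).le
    have hN := hpos _ h
    rw [← toBilin'_self, ← ha.bilin_sharp_self hx, ← ha.bilin_sharp hx]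
    have hw' : Matrix.toBilin' (a x) w (sharp a b x) = 0 := by rw [ha.bilin_symm hx, hw]
    have e : Matrix.toBilin' (a x) y y = Matrix.toBilin' (a x) (sharp a b x) y ^ 2
        / Matrix.toBilin' (a x) (sharp a b x) (sharp a b x) + Matrix.toBilin' (a x) w w := by
      generalize hr : Matrix.toBilin' (a x) (sharp a b x) y = r at *
      rw [hy]
      simp only [map_add, map_smul, LinearMap.add_apply, LinearMap.smul_apply, smul_eq_mul, hw, hw']
      field_simp
      ring
    rw [e, mul_add, mul_div_cancel₀ _ hN.ne']
    nlinarith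

lemma IsRiemannianOn.ratio_sq_le (ha : IsRiemannianOn U a) (hx : x ∈ U) (hy : y ≠ 0) :
    (beta b x y / alpha a x y) ^ 2 ≤ normSq a b x := by
  rw [div_pow, ha.alpha_sq hx, div_le_iff₀ (ha.quad_pos hx hy)]
  exact ha.beta_sq_le hx y

lemma dX_beta (hb : ∀ i, ContDiffOn ℝ ∞ (fun x => b x i) U) (hU : IsOpen U) (hx : x ∈ U)
    (y : Fin n → ℝ) (k : Fin n) : dX k (beta b) x y = ∑ i, pd k (fun z => b z i) x * y i :=
  (smoothOn_beta hb Set.univ).dX_eq (hU.prod isOpen_univ) ⟨hx, trivial⟩ (fun _ _ _ => rfl)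
    (HasDerivAt.fun_sum fun i _ => (hasDerivAt_pd (hb i) hU hx k).mul_const _)

lemma hasDerivAt_linear (c y : Fin n → ℝ) (l : Fin n) :
    HasDerivAt (fun r => ∑ i, c i * coordLine y l r i) (c l) 0 := by
  have h : HasDerivAt (fun r => ∑ i, c i * coordLine y l r i)
      (∑ i, c i * (if i = l then 1 else 0)) 0 :=
    HasDerivAt.fun_sum fun i _ => (hasDerivAt_coordLine_apply y l i).const_mul _
  simpa using h

/-- `α α_{yˡ} = a_{lj} yʲ`. -/
lemma alpha_mul_dY_alpha (ha : IsRiemannianOn U a) (hU : IsOpen U) (hx : x ∈ U) (hy : y ≠ 0)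
    (l : Fin n) : alpha a x y * dY l (alpha a) x y = ∑ j, a x l j * y j := by
  have hW := isOpen_slit hU
  have h1 := dY_sq (smoothOn_alpha ha) hW (x := x) (y := y) ⟨hx, hy⟩ l
  rw [dY_congr hW ⟨hx, hy⟩ (fun x y h => alpha_sq_eq_quad ha x y ⟨h.1, trivial⟩) l,
    dY_quad ha hU hx] at h1
  linarith

lemma hasDerivAt_ratio_right (ha : IsRiemannianOn U a) (hU : IsOpen U) (hx : x ∈ U) (hy : y ≠ 0)
    (l : Fin n) :
    HasDerivAt (fun r => beta b x (coordLine y l r) / alpha a x (coordLine y l r))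
      ((b x l - beta b x y / alpha a x y * dY l (alpha a) x y) / alpha a x y) 0 := by
  have hα := (ha.alpha_pos hx hy).ne'
  have h := (hasDerivAt_linear (b x) y l).fun_div
    ((smoothOn_alpha ha).hasDerivAt_dY (isOpen_slit hU) (x := x) (y := y) ⟨hx, hy⟩ l)
    (by simpa using hα)
  simp only [coordLine_zero] at h
  refine h.congr_deriv ?_
  have hβ : beta b x y = ∑ i, b x i * y i := rfl
  rw [← hβ]
  field_simp

/-- The first derivative `F_{xᵏ} = (φ - s φ₂) α_{xᵏ} + α φ₁ (b²)_{xᵏ} + φ₂ β_{xᵏ}`. -/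
lemma dX_metric (ha : IsRiemannianOn U a) (hb : ∀ i, ContDiffOn ℝ ∞ (fun x => b x i) U)
    (hU : IsOpen U) (hΩ : IsOpen Ω) (hφ : ContDiffOn ℝ ∞ (fun p : ℝ × ℝ => φ p.1 p.2) Ω)
    (hdom : ∀ x ∈ U, ∀ s : ℝ, s ^ 2 ≤ normSq a b x → (normSq a b x, s) ∈ Ω)
    (hF : IsFinslerOn U (metric φ a b)) (hx : x ∈ U) (hy : y ≠ 0) (k : Fin n) :
    dX k (metric φ a b) x y
      = (φ (normSq a b x) (beta b x y / alpha a x y)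
          - beta b x y / alpha a x y * d2 φ (normSq a b x) (beta b x y / alpha a x y))
          * dX k (alpha a) x y
        + alpha a x y * d1 φ (normSq a b x) (beta b x y / alpha a x y) * pd k (normSq a b) x
        + d2 φ (normSq a b x) (beta b x y / alpha a x y)
          * ∑ i, pd k (fun z => b z i) x * y i := by
  have hW := isOpen_slit hU
  have hxy : (x, y) ∈ U ×ˢ ({0}ᶜ : Set (Fin n → ℝ)) := ⟨hx, hy⟩
  have hα := (ha.alpha_pos hx hy).ne'
  refine hF.smoothOn.dX_eq (g := metric φ a b) hW hxy (fun _ _ _ => rfl) ?_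
  have e1 := (smoothOn_alpha ha).hasDerivAt_dX hW hxy k
  have e2 := (smoothOn_beta hb _).hasDerivAt_dX hW hxy k
  have e3 := hasDerivAt_pd (contDiffOn_normSq ha hb) hU hx k
  have e4 := e2.fun_div e1 (by simpa using hα)
  have e5 := e1.fun_mul (hasDerivAt_phi_comp hΩ hφ e3 e4 (by
    simpa using hdom x hx _ (ha.ratio_sq_le hx hy)))
  simp only [coordLine_zero] at e5
  rw [dX_beta hb hU hx] at e5
  refine e5.congr_deriv ?_
  field_simp
  ring

/-- The mixed second derivative `F_{xᵏ yˡ}`. -/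
lemma dY_dX_metric (ha : IsRiemannianOn U a) (hb : ∀ i, ContDiffOn ℝ ∞ (fun x => b x i) U)
    (hU : IsOpen U) (hΩ : IsOpen Ω) (hφ : ContDiffOn ℝ ∞ (fun p : ℝ × ℝ => φ p.1 p.2) Ω)
    (hdom : ∀ x ∈ U, ∀ s : ℝ, s ^ 2 ≤ normSq a b x → (normSq a b x, s) ∈ Ω)
    (hF : IsFinslerOn U (metric φ a b)) (hx : x ∈ U) (hy : y ≠ 0) (k l : Fin n)
    {α s s' t : ℝ} (hα : alpha a x y = α) (hs : beta b x y / alpha a x y = s)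
    (hs' : (b x l - s * dY l (alpha a) x y) / α = s') (ht : normSq a b x = t) :
    dY l (dX k (metric φ a b)) x y
      = -(s * d2 (d2 φ) t s * s') * dX k (alpha a) x y
        + (φ t s - s * d2 φ t s) * dY l (dX k (alpha a)) x y
        + (dY l (alpha a) x y * d1 φ t s + α * (d2 (d1 φ) t s * s')) * pd k (normSq a b) x
        + d2 (d2 φ) t s * s' * (∑ i, pd k (fun z => b z i) x * y i)
        + d2 φ t s * pd k (fun z => b z l) x := by
  have hW := isOpen_slit hU
  have hxy : (x, y) ∈ U ×ˢ ({0}ᶜ : Set (Fin n → ℝ)) := ⟨hx, hy⟩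
  refine (hF.smoothOn.dX hW k).dY_eq (g := fun x y =>
      (φ (normSq a b x) (beta b x y / alpha a x y)
          - beta b x y / alpha a x y * d2 φ (normSq a b x) (beta b x y / alpha a x y))
          * dX k (alpha a) x y
        + alpha a x y * d1 φ (normSq a b x) (beta b x y / alpha a x y) * pd k (normSq a b) x
        + d2 φ (normSq a b x) (beta b x y / alpha a x y)
          * ∑ i, pd k (fun z => b z i) x * y i) hW hxy
    (fun y h => dX_metric ha hb hU hΩ hφ hdom hF hx h.2 k) ?_
  have hmem : (normSq a b x, beta b x (coordLine y l 0) / alpha a x (coordLine y l 0)) ∈ Ω := by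
    simpa using hdom x hx _ (ha.ratio_sq_le hx hy)
  have e1 := (smoothOn_alpha ha).hasDerivAt_dY hW hxy l
  have e2 := ((smoothOn_alpha ha).dX hW k).hasDerivAt_dY hW hxy l
  have e3 := hasDerivAt_ratio_right (b := b) ha hU hx hy l
  have e4 := hasDerivAt_linear (fun i => pd k (fun z => b z i) x) y l
  have f0 := hasDerivAt_phi_comp_right hΩ hφ e3 hmem
  have f1 := hasDerivAt_phi_comp_right hΩ (contDiffOn_d1 hΩ hφ) e3 hmem
  have f2 := hasDerivAt_phi_comp_right hΩ (contDiffOn_d2 hΩ hφ) e3 hmem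
  have h := ((f0.fun_sub (e3.fun_mul f2)).fun_mul e2).fun_add
    ((e1.fun_mul f1).mul_const (pd k (normSq a b) x)) |>.fun_add (f2.fun_mul e4)
  simp only [coordLine_zero] at h
  rw [hs, hα, ht, hs'] at h
  rw [ht]
  refine h.congr_deriv ?_
  ring

/-- `2 bⁱ b_{i|k} yᵏ = (b²)_{xᵏ} yᵏ`. -/
lemma two_mul_bilin_covDeriv_sharp (ha : IsRiemannianOn U a)
    (hb : ∀ i, ContDiffOn ℝ ∞ (fun x => b x i) U) (hU : IsOpen U) (hx : x ∈ U) (y : Fin n → ℝ) :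
    2 * Matrix.toBilin' (Matrix.of (covDeriv a b x)) (sharp a b x) y
      = ∑ k, pd k (normSq a b) x * y k := by
  simp only [pd_normSq ha hb hU hx, Matrix.toBilin'_apply, Matrix.of_apply]
  rw [Finset.sum_comm, Finset.mul_sum]
  refine Finset.sum_congr rfl fun k _ => ?_
  rw [mul_assoc, Finset.sum_mul]

/-- `b_{i|k} yⁱ yᵏ = β_{xᵏ} yᵏ - s α_{xᵏ} yᵏ` when `α` is projectively flat. -/
lemma covDeriv_self_of_flat (ha : IsRiemannianOn U a) (hU : IsOpen U)
    (hflat : IsProjectivelyFlatOn U (alpha a)) (hx : x ∈ U) (hy : y ≠ 0) :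
    Matrix.toBilin' (Matrix.of (covDeriv a b x)) y y
      = (∑ k, (∑ i, pd k (fun z => b z i) x * y i) * y k)
        - beta b x y / alpha a x y * ∑ k, dX k (alpha a) x y * y k := by
  have hα := (ha.alpha_pos hx hy).ne'
  rw [covDeriv_quadratic ha hU hx, Finset.sum_comm]
  congr 1
  · exact Finset.sum_congr rfl fun k _ => by rw [Finset.sum_mul]
  · simp only [hflat x hx y hy, projFactor]
    rw [beta]
    generalize ∑ k, dX k (alpha a) x y * y k = D
    simp only [Finset.mul_sum, Finset.sum_mul, Finset.sum_div]
    exact Finset.sum_congr rfl fun i _ => by field_simp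

/-- The Hamel tensor of `F = α φ(b², β/α)` when `α` is projectively flat. -/
lemma hamel_metric (ha : IsRiemannianOn U a) (hb : ∀ i, ContDiffOn ℝ ∞ (fun x => b x i) U)
    (hU : IsOpen U) (hΩ : IsOpen Ω) (hφ : ContDiffOn ℝ ∞ (fun p : ℝ × ℝ => φ p.1 p.2) Ω)
    (hdom : ∀ x ∈ U, ∀ s : ℝ, s ^ 2 ≤ normSq a b x → (normSq a b x, s) ∈ Ω)
    (hF : IsFinslerOn U (metric φ a b)) (hflat : IsProjectivelyFlatOn U (alpha a))
    (hx : x ∈ U) (hy : y ≠ 0) (l : Fin n)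
    {s t : ℝ} (hs : beta b x y / alpha a x y = s) (ht : normSq a b x = t) :
    hamel (metric φ a b) x y l
      = hamelForm (Matrix.toBilin' (a x)) (Matrix.toBilin' (Matrix.of (covDeriv a b x)))
        (sharp a b x) (alpha a x y) s (d1 φ t s) (d2 (d1 φ) t s) (d2 φ t s) (d2 (d2 φ) t s) y
        (Pi.single l 1) := by
  have hα := (ha.alpha_pos hx hy).ne'
  have hH : hamel (alpha a) x y l = 0 :=
    ((ha.isFinslerOn hU).spray_eq_iff hU hx hy).1 (hflat x hx y hy) l
  -- The entries of `hamelForm` in coordinates.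
  have k1 : Matrix.toBilin' (a x) y (Pi.single l 1) = alpha a x y * dY l (alpha a) x y := by
    rw [alpha_mul_dY_alpha ha hU hx hy, ha.bilin_symm hx, Matrix.toBilin'_apply]
    simp [Pi.single_apply]
  have k2 : Matrix.toBilin' (a x) (sharp a b x) (Pi.single l 1) = b x l := by
    rw [ha.bilin_sharp hx]
    simp [beta, Pi.single_apply]
  have k3 : 2 * Matrix.toBilin' (Matrix.of (covDeriv a b x)) (sharp a b x) (Pi.single l 1)
      = pd l (normSq a b) x := by
    rw [pd_normSq ha hb hU hx, Matrix.toBilin'_apply]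
    simp [Pi.single_apply]
  have k4 := two_mul_bilin_covDeriv_sharp ha hb hU hx y
  have k5 := covDeriv_self_of_flat (b := b) ha hU hflat hx hy
  rw [hs] at k5
  have k6 : Matrix.toBilin' (Matrix.of (covDeriv a b x)) (Pi.single l 1) y
      - Matrix.toBilin' (Matrix.of (covDeriv a b x)) y (Pi.single l 1)
      = (∑ k, pd k (fun z => b z l) x * y k) - ∑ k, pd l (fun z => b z k) x * y k := by
    simp only [Matrix.toBilin'_apply, Matrix.of_apply]
    simp only [Pi.single_apply, ite_mul, one_mul, zero_mul, mul_ite, mul_one, mul_zero,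
      Finset.sum_ite_eq', Finset.mem_univ, if_true]
    rw [Finset.sum_comm]
    simp only [Finset.sum_ite_eq', Finset.mem_univ, if_true, ← Finset.sum_sub_distrib]
    refine Finset.sum_congr rfl fun k _ => ?_
    rw [← sub_mul, ← covDeriv_sub ha hU hx]
    ring
  have hsum : ∑ k, dY l (dX k (metric φ a b)) x y * y k
      = -(s * d2 (d2 φ) t s * ((b x l - s * dY l (alpha a) x y) / alpha a x y))
          * (∑ k, dX k (alpha a) x y * y k)
        + (φ t s - s * d2 φ t s) * (∑ k, dY l (dX k (alpha a)) x y * y k)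
        + (dY l (alpha a) x y * d1 φ t s + alpha a x y * (d2 (d1 φ) t s
          * ((b x l - s * dY l (alpha a) x y) / alpha a x y))) * (∑ k, pd k (normSq a b) x * y k)
        + d2 (d2 φ) t s * ((b x l - s * dY l (alpha a) x y) / alpha a x y)
          * (∑ k, (∑ i, pd k (fun z => b z i) x * y i) * y k)
        + d2 φ t s * ∑ k, pd k (fun z => b z l) x * y k := by
    have hterm : ∀ k, dY l (dX k (metric φ a b)) x y * y k
        = -(s * d2 (d2 φ) t s * ((b x l - s * dY l (alpha a) x y) / alpha a x y))
            * (dX k (alpha a) x y * y k)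
          + (φ t s - s * d2 φ t s) * (dY l (dX k (alpha a)) x y * y k)
          + (dY l (alpha a) x y * d1 φ t s + alpha a x y * (d2 (d1 φ) t s
            * ((b x l - s * dY l (alpha a) x y) / alpha a x y))) * (pd k (normSq a b) x * y k)
          + d2 (d2 φ) t s * ((b x l - s * dY l (alpha a) x y) / alpha a x y)
            * ((∑ i, pd k (fun z => b z i) x * y i) * y k)
          + d2 φ t s * (pd k (fun z => b z l) x * y k) := fun k => by
      rw [dY_dX_metric ha hb hU hΩ hφ hdom hF hx hy k l rfl hs rfl ht]
      ring
    simp only [hterm, Finset.sum_add_distrib, ← Finset.mul_sum]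
  rw [hamel] at hH ⊢
  rw [hsum, dX_metric ha hb hU hΩ hφ hdom hF hx hy, hs, ht, hamelForm, k1, k2, k5, k6, k4,
    mul_div_cancel_left₀ _ hα, mul_div_assoc]
  have hq : alpha a x y * ((b x l - s * dY l (alpha a) x y) / alpha a x y)
      = b x l - s * dY l (alpha a) x y := mul_div_cancel₀ _ hα
  linear_combination (φ t s - s * d2 φ t s) * hH + alpha a x y * d1 φ t s * k3
    + d2 (d1 φ) t s * (∑ k, pd k (normSq a b) x * y k) * hq

end GeneralMetric


/-! ### Functions that are constant near each point of a level set -/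

section Level

variable {n : ℕ} {U : Set (Fin n → ℝ)} {f : (Fin n → ℝ) → ℝ} {x₀ : Fin n → ℝ}

/-- A function on a connected open set that is constant near every point of one level set is
constant. -/
lemma eq_of_locally_const (hU : IsOpen U) (hc : IsPreconnected U) (hf : ContinuousOn f U)
    (hx₀ : x₀ ∈ U) (h : ∀ x ∈ U, f x = f x₀ → ∀ᶠ z in nhds x, f z = f x₀) :
    ∀ x ∈ U, f x = f x₀ := by
  have hv : IsOpen (U ∩ f ⁻¹' {f x₀}ᶜ) := hf.isOpen_inter_preimage hU isOpen_compl_singleton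
  have hsub := hc.subset_left_of_subset_union (u := interior {z | f z = f x₀}) isOpen_interior hv
    (Set.disjoint_left.2 fun z hz hz' => hz'.2 (show f z = f x₀ from
      interior_subset (s := {z | f z = f x₀}) hz)) (fun z hz => by
      by_cases hfz : f z = f x₀
      · exact Or.inl (mem_interior_iff_mem_nhds.2 (h z hz hfz))
      · exact Or.inr ⟨hz, hfz⟩) ⟨x₀, hx₀, mem_interior_iff_mem_nhds.2 (h x₀ hx₀ rfl)⟩
  exact fun x hx => interior_subset (s := {z | f z = f x₀}) (hsub hx)

/-- Grönwall: if `|df| ≤ C |f - f(x₀)|` near `x₀`, then `f` is constant near `x₀`. -/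
lemma eventually_eq_of_fderiv_isBigO (hU : IsOpen U) (hf : DifferentiableOn ℝ f U) (hx₀ : x₀ ∈ U)
    (h : (fun x => fderiv ℝ f x) =O[nhds x₀] fun x => f x - f x₀) :
    ∀ᶠ x in nhds x₀, f x = f x₀ := by
  obtain ⟨C, hC⟩ := h.bound
  obtain ⟨ε, hε, hball⟩ := Metric.eventually_nhds_iff_ball.1 (hC.and (hU.mem_nhds hx₀))
  refine Metric.eventually_nhds_iff_ball.2 ⟨ε, hε, fun x hx => ?_⟩
  have hseg : ∀ r ∈ Set.Icc (0 : ℝ) 1, x₀ + r • (x - x₀) ∈ Metric.ball x₀ ε := fun r hr =>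
    (convex_ball x₀ ε).add_smul_sub_mem (Metric.mem_ball_self hε) hx hr
  have hd : ∀ r ∈ Set.Icc (0 : ℝ) 1, HasDerivAt (fun r : ℝ => f (x₀ + r • (x - x₀)) - f x₀)
      (fderiv ℝ f (x₀ + r • (x - x₀)) (x - x₀)) r := fun r hr => by
    have h1 : HasDerivAt (fun r : ℝ => x₀ + r • (x - x₀)) (x - x₀) r := by
      simpa using ((hasDerivAt_id r).smul_const (x - x₀)).const_add x₀
    have h2 := ((hf _ (hball _ (hseg r hr)).2).differentiableAt
      (hU.mem_nhds (hball _ (hseg r hr)).2)).hasFDerivAt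
    exact (h2.comp_hasDerivAt r h1).sub_const _
  have := eq_zero_of_abs_deriv_le_mul_abs_self_of_eq_zero_right (K := C * ‖x - x₀‖)
    (fun r hr => (hd r hr).continuousAt.continuousWithinAt)
    (fun r hr => (hd r ⟨hr.1, hr.2.le⟩).hasDerivWithinAt) (by simp) (fun r hr => by
      refine (ContinuousLinearMap.le_opNorm _ _).trans ?_
      have := mul_le_mul_of_nonneg_right (hball _ (hseg r ⟨hr.1, hr.2.le⟩)).1 (norm_nonneg (x - x₀))
      linarith) 1 ⟨zero_le_one, le_rfl⟩
  simp only [one_smul, add_sub_cancel] at this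
  linarith

lemma fderiv_isBigO_of_pd {g : (Fin n → ℝ) → ℝ}
    (h : ∀ k, (fun x => pd k f x) =O[nhds x₀] g) : (fun x => fderiv ℝ f x) =O[nhds x₀] g := by
  have he : (fun x => fderiv ℝ f x)
      = fun x => ∑ k, pd k f x • (ContinuousLinearMap.proj k : (Fin n → ℝ) →L[ℝ] ℝ) := by
    ext x v
    conv_lhs => rw [pi_eq_sum_univ' v]
    simp [pd, mul_comm]
  rw [he]
  refine Asymptotics.IsBigO.fun_sum fun k _ => ?_
  have := (h k).smul (Asymptotics.isBigO_refl
    (fun _ : Fin n → ℝ => (ContinuousLinearMap.proj k : (Fin n → ℝ) →L[ℝ] ℝ)) (nhds x₀))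
  refine this.trans ?_
  refine Asymptotics.IsBigO.of_bound ‖(ContinuousLinearMap.proj k : (Fin n → ℝ) →L[ℝ] ℝ)‖ ?_
  filter_upwards with x
  rw [norm_smul, mul_comm]

end Level

/-! ### Consequences of projective flatness at a point -/

section Pointwise

variable {n : ℕ} {U : Set (Fin n → ℝ)} {a : (Fin n → ℝ) → Matrix (Fin n) (Fin n) ℝ}
  {b : (Fin n → ℝ) → Fin n → ℝ} {x y : Fin n → ℝ} {φ : ℝ → ℝ → ℝ} {Ω : Set (ℝ × ℝ)}

lemma hamelForm_eq_zero_of_single {A B : (Fin n → ℝ) →ₗ[ℝ] (Fin n → ℝ) →ₗ[ℝ] ℝ}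
    {b : Fin n → ℝ} {α s p₁ p₁₂ p₂ p₂₂ : ℝ} {y : Fin n → ℝ}
    (h : ∀ l, hamelForm A B b α s p₁ p₁₂ p₂ p₂₂ y (Pi.single l 1) = 0) (z : Fin n → ℝ) :
    hamelForm A B b α s p₁ p₁₂ p₂ p₂₂ y z = 0 := by
  let L : (Fin n → ℝ) →ₗ[ℝ] ℝ :=
    (2 * B b y * (p₁ - s * p₁₂) / α) • A y + (2 * B b y * p₁₂) • A b
      + (p₂₂ * B y y / α) • (A b - (s / α) • A y) + p₂ • (B.flip y - B y) - (2 * α * p₁) • B b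
  have hL : ∀ z, hamelForm A B b α s p₁ p₁₂ p₂ p₂₂ y z = L z := by
    intro z
    simp [L, hamelForm]
    ring
  rw [hL, pi_eq_sum_univ' z, map_sum]
  exact Finset.sum_eq_zero fun l _ => by rw [map_smul, ← hL, h l, smul_zero]

/-- At a point where `F` is projectively flat, the Hamel tensor vanishes for all directions. -/
lemma hamelFlat_of_flat (ha : IsRiemannianOn U a) (hb : ∀ i, ContDiffOn ℝ ∞ (fun x => b x i) U)
    (hU : IsOpen U) (hΩ : IsOpen Ω) (hφ : ContDiffOn ℝ ∞ (fun p : ℝ × ℝ => φ p.1 p.2) Ω)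
    (hdom : ∀ x ∈ U, ∀ s : ℝ, s ^ 2 ≤ normSq a b x → (normSq a b x, s) ∈ Ω)
    (hF : IsFinslerOn U (metric φ a b)) (hα : IsProjectivelyFlatOn U (alpha a))
    (hflat : IsProjectivelyFlatOn U (metric φ a b)) (hx : x ∈ U) :
    HamelFlat (Matrix.toBilin' (a x)) (Matrix.toBilin' (Matrix.of (covDeriv a b x)))
      (sharp a b x) (d1 φ (normSq a b x)) (d2 (d1 φ) (normSq a b x)) (d2 φ (normSq a b x))
      (d2 (d2 φ) (normSq a b x)) := by
  intro y hy
  have hy0 : y ≠ 0 := by rintro rfl; simp at hy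
  have h1 : alpha a x y = 1 := by
    rw [toBilin'_self] at hy
    have : alpha a x y = Real.sqrt (quad a x y) := rfl
    rw [this, hy, Real.sqrt_one]
  rw [ha.bilin_sharp hx]
  refine hamelForm_eq_zero_of_single fun l => ?_
  have h2 := (hF.spray_eq_iff hU hx hy0).1 (hflat x hx y hy0) l
  rwa [hamel_metric ha hb hU hΩ hφ hdom hF hα hx hy0 l rfl rfl, h1, div_one] at h2

lemma covDeriv_eq_bilin (x : Fin n → ℝ) (i j : Fin n) :
    covDeriv a b x i j = Matrix.toBilin' (Matrix.of (covDeriv a b x)) (Pi.single i 1)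
      (Pi.single j 1) := by
  rw [Matrix.toBilin'_single, Matrix.of_apply]

lemma beta_single (x : Fin n → ℝ) (i : Fin n) : beta b x (Pi.single i 1) = b x i := by
  simp [beta, Pi.single_apply]

/-- Near a point where the smooth function `φ₂₂(t, ·)` is nonzero there are values of `s` off zero
at which neither `φ₂` nor `φ₂₂` vanishes. -/
lemma exists_d2_ne_zero (hΩ : IsOpen Ω) (hφ : ContDiffOn ℝ ∞ (fun p : ℝ × ℝ => φ p.1 p.2) Ω)
    {t s₁ : ℝ} (hmem : (t, s₁) ∈ Ω) (hs₁ : s₁ ^ 2 < t) (h : d2 (d2 φ) t s₁ ≠ 0) :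
    ∃ s, s ≠ 0 ∧ s ^ 2 < t ∧ d2 φ t s ≠ 0 ∧ d2 (d2 φ) t s ≠ 0 := by
  have hφ2 := contDiffOn_d2 hΩ hφ
  have hφ22 := contDiffOn_d2 hΩ hφ2
  have hline : ContinuousAt (fun s : ℝ => (t, s)) s₁ := by fun_prop
  have hd : HasDerivAt (fun s => d2 φ t s) (d2 (d2 φ) t s₁) s₁ := by
    have h1 : DifferentiableAt ℝ (fun p : ℝ × ℝ => d2 φ p.1 p.2) (t, s₁) :=
      (hφ2.contDiffAt (hΩ.mem_nhds hmem)).differentiableAt (by simp)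
    have h2 : DifferentiableAt ℝ (fun s => d2 φ t s) s₁ :=
      DifferentiableAt.comp s₁ (f := fun s : ℝ => (t, s)) h1 (by fun_prop)
    exact h2.hasDerivAt
  have hc : ContinuousAt (fun s => d2 (d2 φ) t s) s₁ :=
    ContinuousAt.comp (f := fun s : ℝ => (t, s)) (g := fun p : ℝ × ℝ => d2 (d2 φ) p.1 p.2)
      (hφ22.contDiffAt (hΩ.mem_nhds hmem)).continuousAt hline
  have e1 : ∀ᶠ s in nhdsWithin s₁ {s₁}ᶜ, d2 φ t s ≠ 0 := hd.eventually_ne h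
  have e2 : ∀ᶠ s in nhdsWithin s₁ {s₁}ᶜ, d2 (d2 φ) t s ≠ 0 :=
    (hc.eventually_ne h).filter_mono nhdsWithin_le_nhds
  have e3 : ∀ᶠ s in nhdsWithin s₁ {s₁}ᶜ, s ^ 2 < t :=
    (((continuous_pow 2).continuousAt (x := s₁)).eventually_lt continuousAt_const hs₁).filter_mono
      nhdsWithin_le_nhds
  have e4 : ∀ᶠ s in nhdsWithin s₁ {s₁}ᶜ, s ≠ 0 := by
    rcases eq_or_ne s₁ 0 with rfl | h0
    · exact self_mem_nhdsWithin
    · exact (continuousAt_id.eventually_ne h0).filter_mono nhdsWithin_le_nhds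
  obtain ⟨s, h1, h2, h3, h4⟩ := (e1.and (e2.and (e3.and e4))).exists
  exact ⟨s, h4, h3, h1, h2⟩

/-- A continuous function of `s` that is nonzero somewhere on `s² ≤ t` is nonzero somewhere on
`s² < t`. -/
lemma exists_interior_ne_zero {f : ℝ → ℝ} {t s : ℝ} (ht : 0 < t) (hs : s ^ 2 ≤ t)
    (hf : ContinuousAt f s) (h : f s ≠ 0) : ∃ s', s' ^ 2 < t ∧ f s' ≠ 0 := by
  have hg : ContinuousAt (fun r : ℝ => f (r * s)) 1 := by
    refine ContinuousAt.comp (f := fun r : ℝ => r * s) ?_ (by fun_prop)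
    simpa using hf
  have e1 : ∀ᶠ r in nhdsWithin (1 : ℝ) (Set.Iio 1), f (r * s) ≠ 0 :=
    (hg.eventually_ne (by simpa using h)).filter_mono nhdsWithin_le_nhds
  have e2 : ∀ᶠ r in nhdsWithin (1 : ℝ) (Set.Iio 1), 0 < r :=
    (lt_mem_nhds zero_lt_one).filter_mono nhdsWithin_le_nhds
  have e3 : ∀ᶠ r in nhdsWithin (1 : ℝ) (Set.Iio 1), r < 1 := self_mem_nhdsWithin
  obtain ⟨r, h1, h2, h3⟩ := (e1.and (e2.and e3)).exists
  refine ⟨r * s, ?_, h1⟩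
  have hr : r ^ 2 < 1 := by nlinarith
  rw [mul_pow]
  nlinarith [sq_nonneg s]

end Pointwise


/-! ### Necessity of the structure equations -/

section Necessity

variable {n : ℕ} {U : Set (Fin n → ℝ)} {a : (Fin n → ℝ) → Matrix (Fin n) (Fin n) ℝ}
  {b : (Fin n → ℝ) → Fin n → ℝ} {x y x₀ : Fin n → ℝ} {φ : ℝ → ℝ → ℝ} {Ω : Set (ℝ × ℝ)}

/-- The vanishing of the Hamel tensor of `α φ(b², β/α)` over the point `x`. -/
def FlatAt (φ : ℝ → ℝ → ℝ) (a : (Fin n → ℝ) → Matrix (Fin n) (Fin n) ℝ)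
    (b : (Fin n → ℝ) → Fin n → ℝ) (x : Fin n → ℝ) : Prop :=
  HamelFlat (Matrix.toBilin' (a x)) (Matrix.toBilin' (Matrix.of (covDeriv a b x)))
    (sharp a b x) (d1 φ (normSq a b x)) (d2 (d1 φ) (normSq a b x)) (d2 φ (normSq a b x))
    (d2 (d2 φ) (normSq a b x))

/-- `b_{i|j} bⁱ bʲ`. -/
def covSharp (a : (Fin n → ℝ) → Matrix (Fin n) (Fin n) ℝ) (b : (Fin n → ℝ) → Fin n → ℝ)
    (x : Fin n → ℝ) : ℝ :=
  Matrix.toBilin' (Matrix.of (covDeriv a b x)) (sharp a b x) (sharp a b x)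

/-- The function `c = 2 φ₁(t, 0) / φ₂₂(t, 0)`, obtained by putting `s = 0` in the differential
equation. -/
def structureC (φ : ℝ → ℝ → ℝ) (t : ℝ) : ℝ := 2 * d1 φ t 0 / d2 (d2 φ) t 0

lemma three_le_finrank (hn : 3 ≤ n) : 3 ≤ Module.finrank ℝ (Fin n → ℝ) := by simpa using hn

lemma normSq_eq_zero (h : b x = 0) : normSq a b x = 0 := by simp [normSq, h]

lemma contDiffAt_left {ψ : ℝ → ℝ → ℝ} (hΩ : IsOpen Ω)
    (hψ : ContDiffOn ℝ ∞ (fun p : ℝ × ℝ => ψ p.1 p.2) Ω) {t s : ℝ} (h : (t, s) ∈ Ω) :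
    ContDiffAt ℝ ∞ (fun t => ψ t s) t :=
  ContDiffAt.comp t (f := fun t : ℝ => (t, s)) (hψ.contDiffAt (hΩ.mem_nhds h))
    (contDiffAt_id.prodMk contDiffAt_const)

lemma contDiffAt_right {ψ : ℝ → ℝ → ℝ} (hΩ : IsOpen Ω)
    (hψ : ContDiffOn ℝ ∞ (fun p : ℝ × ℝ => ψ p.1 p.2) Ω) {t s : ℝ} (h : (t, s) ∈ Ω) :
    ContDiffAt ℝ ∞ (fun s => ψ t s) s :=
  ContDiffAt.comp s (f := fun s : ℝ => (t, s)) (hψ.contDiffAt (hΩ.mem_nhds h))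
    (contDiffAt_const.prodMk contDiffAt_id)

lemma two_mul_bilin_single (ha : IsRiemannianOn U a)
    (hb : ∀ i, ContDiffOn ℝ ∞ (fun x => b x i) U) (hU : IsOpen U) (hx : x ∈ U) (k : Fin n) :
    2 * Matrix.toBilin' (Matrix.of (covDeriv a b x)) (sharp a b x) (Pi.single k 1)
      = pd k (normSq a b) x := by
  rw [two_mul_bilin_covDeriv_sharp ha hb hU hx]
  simp [Pi.single_apply]

/-- The differential of `b²` is `2 (b_{i|j} bⁱ bʲ / b²) β`. -/
lemma FlatAt.normSq_mul_pd (h : FlatAt φ a b x) (hn : 3 ≤ n) (ha : IsRiemannianOn U a)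
    (hb : ∀ i, ContDiffOn ℝ ∞ (fun x => b x i) U) (hU : IsOpen U) (hx : x ∈ nonzeroSet U b)
    (h1 : d1 φ (normSq a b x) 0 ≠ 0) (k : Fin n) :
    normSq a b x * pd k (normSq a b) x = 2 * covSharp a b x * b x k := by
  have e := HamelFlat.apply_eq h (three_le_finrank hn) (ha.bilin_pos hx.1)
    (ha.sharp_ne_zero hx.1 hx.2) h1 (Pi.single k 1)
  rw [ha.bilin_sharp_self hx.1, ha.bilin_sharp hx.1, beta_single] at e
  rw [← two_mul_bilin_single ha hb hU hx.1, covSharp]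
  linear_combination 2 * e

/-- The differential of `b²` is a multiple of `φ₂₂(b², 0)`, with a factor that may be computed
from any vector orthogonal to `β`. -/
lemma FlatAt.pd_normSq_eq (h : FlatAt φ a b x) (hn : 3 ≤ n) (ha : IsRiemannianOn U a)
    (hb : ∀ i, ContDiffOn ℝ ∞ (fun x => b x i) U) (hU : IsOpen U) (hx : x ∈ nonzeroSet U b)
    (h1 : d1 φ (normSq a b x) 0 ≠ 0) (hy : beta b x y = 0) (k : Fin n) :
    d1 φ (normSq a b x) 0 * quad a x y * pd k (normSq a b) x
      = d2 (d2 φ) (normSq a b x) 0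
        * (Matrix.toBilin' (Matrix.of (covDeriv a b x)) y y * b x k) := by
  have hN := (ha.normSq_pos hx.1 hx.2).ne'
  have e1 := h.normSq_mul_pd hn ha hb hU hx h1 k
  have e2 := HamelFlat.orthogonal_eq h (three_le_finrank hn) (ha.bilin_pos hx.1)
    (ha.bilin_symm hx.1) h1 (y := y) (by rw [ha.bilin_sharp hx.1, hy])
  rw [ha.bilin_sharp_self hx.1, toBilin'_self] at e2
  apply mul_left_cancel₀ hN
  rw [covSharp] at e1
  linear_combination d1 φ (normSq a b x) 0 * quad a x y * e1 + b x k * e2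

lemma eventually_mem_nonzeroSet (ha : IsRiemannianOn U a)
    (hb : ∀ i, ContDiffOn ℝ ∞ (fun x => b x i) U) (hU : IsOpen U) (hx : x ∈ nonzeroSet U b) :
    ∀ᶠ z in nhds x, z ∈ nonzeroSet U b := by
  have hc := ((contDiffOn_normSq ha hb).contDiffAt (hU.mem_nhds hx.1)).continuousAt
  filter_upwards [hU.mem_nhds hx.1, hc.eventually_ne (ha.normSq_pos hx.1 hx.2).ne'] with z hz hz'
  exact ⟨hz, fun h => hz' (normSq_eq_zero h)⟩

/-- If `φ₂₂(b², 0)` vanishes at a point where `β ≠ 0`, then `b²` is constant near that point: it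
solves a linear differential inequality. -/
lemma eventually_normSq_eq (hn : 3 ≤ n) (ha : IsRiemannianOn U a)
    (hb : ∀ i, ContDiffOn ℝ ∞ (fun x => b x i) U) (hU : IsOpen U) (hΩ : IsOpen Ω)
    (hφ : ContDiffOn ℝ ∞ (fun p : ℝ × ℝ => φ p.1 p.2) Ω)
    (hdom : ∀ x ∈ U, ∀ s : ℝ, s ^ 2 ≤ normSq a b x → (normSq a b x, s) ∈ Ω)
    (hφ1 : ∀ x ∈ U, d1 φ (normSq a b x) 0 ≠ 0) (hP : ∀ x ∈ U, FlatAt φ a b x)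
    (hx₀ : x₀ ∈ nonzeroSet U b) (h0 : d2 (d2 φ) (normSq a b x₀) 0 = 0) :
    ∀ᶠ x in nhds x₀, normSq a b x = normSq a b x₀ := by
  have hNpos := ha.normSq_pos hx₀.1 hx₀.2
  have hmem : (normSq a b x₀, (0 : ℝ)) ∈ Ω := hdom x₀ hx₀.1 0 (by simpa using hNpos.le)
  have hNc := ((contDiffOn_normSq ha hb).contDiffAt (hU.mem_nhds hx₀.1)).continuousAt
  refine eventually_eq_of_fderiv_isBigO hU ((contDiffOn_normSq ha hb).differentiableOn (by simp))
    hx₀.1 (fderiv_isBigO_of_pd fun k => ?_)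
  obtain ⟨y₀, hy₀, hβ₀, -⟩ := exists_ne_zero_of_two_functionals (three_le_finrank hn)
    (Matrix.toBilin' (a x₀) (sharp a b x₀)) 0
  rw [ha.bilin_sharp hx₀.1] at hβ₀
  -- A continuous vector field orthogonal to `β` which does not vanish at `x₀`.
  set Y : (Fin n → ℝ) → Fin n → ℝ :=
    fun x => y₀ - (beta b x y₀ / normSq a b x) • sharp a b x with hY
  have hY0 : Y x₀ = y₀ := by simp [hY, hβ₀]
  have hbc : ∀ i, ContinuousAt (fun x => b x i) x₀ := fun i =>
    ((hb i).contDiffAt (hU.mem_nhds hx₀.1)).continuousAt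
  have hYc : ∀ i, ContinuousAt (fun x => Y x i) x₀ := by
    intro i
    have h1 : ContinuousAt (fun x => sharp a b x i) x₀ :=
      ((contDiffOn_sharp ha hb i).contDiffAt (hU.mem_nhds hx₀.1)).continuousAt
    have h2 : ContinuousAt (fun x => beta b x y₀) x₀ :=
      tendsto_finsetSum _ fun i _ => ((hbc i).mul continuousAt_const)
    exact continuousAt_const.sub ((h2.div hNc hNpos.ne').mul h1)
  have hqc : ContinuousAt (fun x => quad a x (Y x)) x₀ :=
    tendsto_finsetSum _ fun i _ => tendsto_finsetSum _ fun j _ =>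
      ((((ha.1 i j).contDiffAt (hU.mem_nhds hx₀.1)).continuousAt.mul (hYc i)).mul (hYc j))
  have hBc : ContinuousAt
      (fun x => Matrix.toBilin' (Matrix.of (covDeriv a b x)) (Y x) (Y x)) x₀ := by
    simp only [Matrix.toBilin'_apply, Matrix.of_apply]
    exact tendsto_finsetSum _ fun i _ => tendsto_finsetSum _ fun j _ =>
      (((hYc i).mul ((contDiffOn_covDeriv ha hb hU i j).contDiffAt
        (hU.mem_nhds hx₀.1)).continuousAt).mul (hYc j))
  have hf1c : ContinuousAt (fun x => d1 φ (normSq a b x) 0) x₀ :=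
    ContinuousAt.comp (g := fun t => d1 φ t 0)
      (contDiffAt_left hΩ (contDiffOn_d1 hΩ hφ) hmem).continuousAt hNc
  have hden : d1 φ (normSq a b x₀) 0 * quad a x₀ (Y x₀) ≠ 0 := by
    rw [hY0]
    exact mul_ne_zero (hφ1 x₀ hx₀.1) (ha.quad_pos hx₀.1 hy₀).ne'
  have hgc := (hBc.mul (hbc k)).div (hf1c.mul hqc) hden
  have he : (fun x => d2 (d2 φ) (normSq a b x) 0 - d2 (d2 φ) (normSq a b x₀) 0)
      =O[nhds x₀] fun x => normSq a b x - normSq a b x₀ :=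
    (((contDiffAt_left hΩ (contDiffOn_d2 hΩ (contDiffOn_d2 hΩ hφ)) hmem).differentiableAt
      (by simp)).isBigO_sub).comp_tendsto hNc
  have hO := he.mul (hgc.tendsto.isBigO_one ℝ)
  simp only [h0, sub_zero, mul_one] at hO
  refine Asymptotics.IsBigO.congr' hO ?_ Filter.EventuallyEq.rfl
  filter_upwards [eventually_mem_nonzeroSet ha hb hU hx₀, (hf1c.mul hqc).eventually_ne hden]
    with x hx hx'
  have hN := (ha.normSq_pos hx.1 hx.2).ne'
  have hβ : beta b x (Y x) = 0 := by
    rw [← ha.bilin_sharp hx.1, hY]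
    simp only [map_sub, map_smul, smul_eq_mul, ha.bilin_sharp_self hx.1]
    rw [ha.bilin_sharp hx.1, div_mul_cancel₀ _ hN, sub_self]
  have e := (hP x hx.1).pd_normSq_eq hn ha hb hU hx (hφ1 x hx.1) hβ k
  simp only [Pi.mul_apply, Pi.div_apply] at hx' ⊢
  rw [← mul_div_assoc, div_eq_iff hx', ← e, mul_comm]

/-- If `φ₂₂(b², 0)` vanishes at some point where `β ≠ 0`, then `b²` is constant, and `β` is
parallel unless `φ₂₂` is identically zero. -/
lemma isParallelOn_of_degenerate (hn : 3 ≤ n) (ha : IsRiemannianOn U a)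
    (hb : ∀ i, ContDiffOn ℝ ∞ (fun x => b x i) U) (hU : IsOpen U) (hUc : IsConnected U)
    (hΩ : IsOpen Ω) (hφ : ContDiffOn ℝ ∞ (fun p : ℝ × ℝ => φ p.1 p.2) Ω)
    (hdom : ∀ x ∈ U, ∀ s : ℝ, s ^ 2 ≤ normSq a b x → (normSq a b x, s) ∈ Ω)
    (hφ1 : ∀ x ∈ U, d1 φ (normSq a b x) 0 ≠ 0) (hP : ∀ x ∈ U, FlatAt φ a b x)
    (hφ22 : (∃ x ∈ U, ∃ s : ℝ, s ^ 2 ≤ normSq a b x ∧ d2 (d2 φ) (normSq a b x) s ≠ 0) ∨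
      (∃ x ∈ U, ∃ x' ∈ U, normSq a b x ≠ normSq a b x'))
    (hx₀ : x₀ ∈ nonzeroSet U b) (h0 : d2 (d2 φ) (normSq a b x₀) 0 = 0) : IsParallelOn U a b := by
  have hNpos := ha.normSq_pos hx₀.1 hx₀.2
  have hnz : ∀ x ∈ U, normSq a b x = normSq a b x₀ → x ∈ nonzeroSet U b := fun x hx h =>
    ⟨hx, fun hbx => hNpos.ne' (by rw [← h, normSq_eq_zero hbx])⟩
  have hconst : ∀ x ∈ U, normSq a b x = normSq a b x₀ := by
    refine eq_of_locally_const hU hUc.isPreconnected (contDiffOn_normSq ha hb).continuousOn hx₀.1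
      fun x hx h => ?_
    rw [← h]
    exact eventually_normSq_eq hn ha hb hU hΩ hφ hdom hφ1 hP (hnz x hx h) (by rw [h, h0])
  rcases hφ22 with ⟨x₁, hx₁, s, hs, h⟩ | ⟨x, hx, x', hx', h⟩
  swap
  · exact absurd ((hconst x hx).trans (hconst x' hx').symm) h
  have hmem := hdom x₁ hx₁ s hs
  rw [hconst x₁ hx₁] at hs h hmem
  have hφ22 := contDiffOn_d2 hΩ (contDiffOn_d2 hΩ hφ)
  obtain ⟨s₁, hs₁, h₁⟩ := exists_interior_ne_zero hNpos hs
    (contDiffAt_right hΩ hφ22 hmem).continuousAt h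
  obtain ⟨s₂, hs0, hs₂, h2, h22⟩ := exists_d2_ne_zero hΩ hφ (hdom x₀ hx₀.1 s₁ hs₁.le) hs₁ h₁
  intro x hx i j
  have hN := hconst x hx
  have hbx := hnz x hx hN
  have hflat := hP x hx
  rw [covDeriv_eq_bilin]
  refine HamelFlat.eq_zero hflat (three_le_finrank hn) (ha.bilin_pos hx) (ha.bilin_symm hx)
    (ha.sharp_ne_zero hx hbx.2) (hφ1 x hx) ?_ hs0 ?_ ?_ ?_ _ _
  · rw [hN, h0]
  · rwa [ha.bilin_sharp_self hx, hN]
  · rwa [hN]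
  · rwa [hN]

/-- `β` is closed at points where `φ₂₂(b², 0) ≠ 0`. -/
lemma FlatAt.symm (h : FlatAt φ a b x) (hn : 3 ≤ n) (ha : IsRiemannianOn U a) (hΩ : IsOpen Ω)
    (hφ : ContDiffOn ℝ ∞ (fun p : ℝ × ℝ => φ p.1 p.2) Ω)
    (hdom : ∀ x ∈ U, ∀ s : ℝ, s ^ 2 ≤ normSq a b x → (normSq a b x, s) ∈ Ω)
    (hx : x ∈ nonzeroSet U b) (h1 : d1 φ (normSq a b x) 0 ≠ 0)
    (h22 : d2 (d2 φ) (normSq a b x) 0 ≠ 0) (z w : Fin n → ℝ) :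
    Matrix.toBilin' (Matrix.of (covDeriv a b x)) z w
      = Matrix.toBilin' (Matrix.of (covDeriv a b x)) w z := by
  have hN := ha.normSq_pos hx.1 hx.2
  obtain ⟨s, hs0, hs, h2, -⟩ := exists_d2_ne_zero hΩ hφ
    (hdom x hx.1 0 (by simpa using hN.le)) (by simpa using hN) h22
  exact HamelFlat.symm h (three_le_finrank hn) (ha.bilin_pos hx.1) (ha.bilin_symm hx.1)
    (ha.sharp_ne_zero hx.1 hx.2) h1 hs0 (by rwa [ha.bilin_sharp_self hx.1]) h2 z w

lemma FlatAt.covDeriv_eq (h : FlatAt φ a b x) (hn : 3 ≤ n) (ha : IsRiemannianOn U a)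
    (hΩ : IsOpen Ω) (hφ : ContDiffOn ℝ ∞ (fun p : ℝ × ℝ => φ p.1 p.2) Ω)
    (hdom : ∀ x ∈ U, ∀ s : ℝ, s ^ 2 ≤ normSq a b x → (normSq a b x, s) ∈ Ω)
    (hx : x ∈ nonzeroSet U b) (h1 : d1 φ (normSq a b x) 0 ≠ 0)
    (h22 : d2 (d2 φ) (normSq a b x) 0 ≠ 0) (i j : Fin n) :
    covDeriv a b x i j
      = covSharp a b x / normSq a b x ^ 2 * structureC φ (normSq a b x)
          * (normSq a b x * a x i j - b x i * b x j)
        + covSharp a b x / normSq a b x ^ 2 * (b x i * b x j) := by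
  rw [covDeriv_eq_bilin, HamelFlat.form_eq h (three_le_finrank hn) (ha.bilin_pos hx.1)
    (ha.bilin_symm hx.1) (ha.sharp_ne_zero hx.1 hx.2) h1 h22
    (h.symm hn ha hΩ hφ hdom hx h1 h22), ha.bilin_sharp_self hx.1, ha.bilin_sharp hx.1,
    ha.bilin_sharp hx.1, beta_single, beta_single, Matrix.toBilin'_single]
  rfl

lemma contDiffAt_structureC (hΩ : IsOpen Ω)
    (hφ : ContDiffOn ℝ ∞ (fun p : ℝ × ℝ => φ p.1 p.2) Ω) {T : Set ℝ}
    (hT : ∀ t ∈ T, (t, (0 : ℝ)) ∈ Ω) (h22 : ∀ t ∈ T, d2 (d2 φ) t 0 ≠ 0) :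
    ∀ t ∈ T, ContDiffAt ℝ ∞ (structureC φ) t := fun t ht =>
  (contDiffAt_const.mul (contDiffAt_left hΩ (contDiffOn_d1 hΩ hφ) (hT t ht))).div
    (contDiffAt_left hΩ (contDiffOn_d2 hΩ (contDiffOn_d2 hΩ hφ)) (hT t ht)) (h22 t ht)

/-- If `φ₂₂(b², 0)` vanishes nowhere on `U*`, the structure equations hold, unless `β` is parallel.
The differential equation for `φ` is immediate at values of `b²` where `β` is not parallel; if it
failed at some value, it would fail at all nearby ones, and `b²` would be constant. -/
lemma structureEqs_of_nondegenerate (hn : 3 ≤ n) (ha : IsRiemannianOn U a)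
    (hb : ∀ i, ContDiffOn ℝ ∞ (fun x => b x i) U) (hU : IsOpen U) (hUc : IsConnected U)
    (hΩ : IsOpen Ω) (hφ : ContDiffOn ℝ ∞ (fun p : ℝ × ℝ => φ p.1 p.2) Ω)
    (hdom : ∀ x ∈ U, ∀ s : ℝ, s ^ 2 ≤ normSq a b x → (normSq a b x, s) ∈ Ω)
    (hφ1 : ∀ x ∈ U, d1 φ (normSq a b x) 0 ≠ 0) (hP : ∀ x ∈ U, FlatAt φ a b x)
    (h22 : ∀ x ∈ nonzeroSet U b, d2 (d2 φ) (normSq a b x) 0 ≠ 0) (hpar : ¬ IsParallelOn U a b) :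
    StructureEqs U φ a b (structureC φ) (fun x => covSharp a b x / normSq a b x ^ 2) := by
  refine ⟨?_, fun x hx i j =>
    (hP x hx.1).covDeriv_eq hn ha hΩ hφ hdom hx (hφ1 x hx.1) (h22 x hx) i j⟩
  rintro _ ⟨x₀, hx₀, rfl⟩ s₀ hs₀
  by_contra hne
  have hNpos := ha.normSq_pos hx₀.1 hx₀.2
  have q1 := contDiffOn_d1 hΩ hφ
  have q2 := contDiffOn_d2 hΩ hφ
  have q12 := contDiffOn_d2 hΩ q1
  have q22 := contDiffOn_d2 hΩ q2
  set E : ℝ → ℝ → ℝ := fun t s =>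
    (structureC φ t * t - (structureC φ t - 1) * s ^ 2) * d2 (d2 φ) t s
      - 2 * t * (d1 φ t s - s * d2 (d1 φ) t s) with hE
  obtain ⟨s₁, hs₁, hE₁⟩ : ∃ s, s ^ 2 < normSq a b x₀ ∧ E (normSq a b x₀) s ≠ 0 := by
    refine exists_interior_ne_zero hNpos hs₀ ?_ (sub_ne_zero.2 hne)
    have hmem := hdom x₀ hx₀.1 s₀ hs₀
    have c1 := (contDiffAt_right hΩ q1 hmem).continuousAt
    have c12 := (contDiffAt_right hΩ q12 hmem).continuousAt
    have c22 := (contDiffAt_right hΩ q22 hmem).continuousAt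
    fun_prop
  have hmem := hdom x₀ hx₀.1 s₁ hs₁.le
  have hmem0 := hdom x₀ hx₀.1 0 (by simpa using hNpos.le)
  have hEc : ContinuousAt (fun t => E t s₁) (normSq a b x₀) := by
    have c1 := (contDiffAt_left hΩ q1 hmem).continuousAt
    have c12 := (contDiffAt_left hΩ q12 hmem).continuousAt
    have c22 := (contDiffAt_left hΩ q22 hmem).continuousAt
    have cc := (contDiffAt_structureC hΩ hφ (T := {normSq a b x₀}) (by simpa using hmem0)
      (by simpa using h22 x₀ hx₀) _ rfl).continuousAt
    fun_prop
  have hcov : ∀ x ∈ nonzeroSet U b, s₁ ^ 2 < normSq a b x → E (normSq a b x) s₁ ≠ 0 →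
      covSharp a b x = 0 := by
    intro x hx hs hEx
    by_contra hB
    apply hEx
    have := HamelFlat.ode (hP x hx.1) (three_le_finrank hn) (ha.bilin_pos hx.1)
      (ha.bilin_symm hx.1) (ha.sharp_ne_zero hx.1 hx.2) (hφ1 x hx.1) (h22 x hx)
      ((hP x hx.1).symm hn ha hΩ hφ hdom hx (hφ1 x hx.1) (h22 x hx)) hB
      (s := s₁) (by rwa [ha.bilin_sharp_self hx.1])
    rw [ha.bilin_sharp_self hx.1] at this
    simp only [hE, structureC]
    linarith
  have hnz : ∀ x ∈ U, normSq a b x = normSq a b x₀ → x ∈ nonzeroSet U b := fun x hx h =>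
    ⟨hx, fun hbx => hNpos.ne' (by rw [← h, normSq_eq_zero hbx])⟩
  have hconst : ∀ x ∈ U, normSq a b x = normSq a b x₀ := by
    refine eq_of_locally_const hU hUc.isPreconnected (contDiffOn_normSq ha hb).continuousOn hx₀.1
      fun x hx h => ?_
    rw [← h]
    refine eventually_eq_of_fderiv_isBigO hU
      ((contDiffOn_normSq ha hb).differentiableOn (by simp)) hx (fderiv_isBigO_of_pd fun k => ?_)
    have hNc := ((contDiffOn_normSq ha hb).contDiffAt (hU.mem_nhds hx)).continuousAt
    rw [← h] at hEc hE₁ hs₁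
    have hEc' : ContinuousAt (fun z => E (normSq a b z) s₁) x :=
      ContinuousAt.comp (g := fun t => E t s₁) hEc hNc
    refine (Asymptotics.isBigO_zero _ _).congr' ?_ Filter.EventuallyEq.rfl
    filter_upwards [eventually_mem_nonzeroSet ha hb hU (hnz x hx h), hEc'.eventually_ne hE₁,
      continuousAt_const.eventually_lt hNc hs₁] with z hz hEz hsz
    have hNz := (ha.normSq_pos hz.1 hz.2).ne'
    have e := (hP z hz.1).normSq_mul_pd hn ha hb hU hz (hφ1 z hz.1) k
    rw [hcov z hz hsz hEz, mul_zero, zero_mul] at e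
    exact ((mul_eq_zero.1 e).resolve_left hNz).symm
  apply hpar
  intro x hx i j
  have hxz := hnz x hx (hconst x hx)
  rw [(hP x hx).covDeriv_eq hn ha hΩ hφ hdom hxz (hφ1 x hx) (h22 x hxz),
    hcov x hxz (by rwa [hconst x hx]) (by rwa [hconst x hx])]
  simp

lemma contDiffOn_covSharp_div (ha : IsRiemannianOn U a)
    (hb : ∀ i, ContDiffOn ℝ ∞ (fun x => b x i) U) (hU : IsOpen U) :
    ContDiffOn ℝ ∞ (fun x => covSharp a b x / normSq a b x ^ 2) (nonzeroSet U b) := by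
  have hsub : nonzeroSet U b ⊆ U := fun x hx => hx.1
  refine ContDiffOn.div ?_ (((contDiffOn_normSq ha hb).mono hsub).pow 2)
    fun x hx => pow_ne_zero 2 (ha.normSq_pos hx.1 hx.2).ne'
  have he : covSharp a b = fun x => ∑ i, ∑ j,
      sharp a b x i * covDeriv a b x i j * sharp a b x j := by
    funext x
    rw [covSharp, Matrix.toBilin'_apply]
    rfl
  rw [he]
  exact ContDiffOn.sum fun i _ => ContDiffOn.sum fun j _ =>
    ((((contDiffOn_sharp ha hb i).mul (contDiffOn_covDeriv ha hb hU i j)).mul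
      (contDiffOn_sharp ha hb j)).mono hsub)

end Necessity


/-! ### Sufficiency of the structure equations and the geodesic coefficients -/

section Sufficiency

variable {n : ℕ} {U : Set (Fin n → ℝ)} {a : (Fin n → ℝ) → Matrix (Fin n) (Fin n) ℝ}
  {b : (Fin n → ℝ) → Fin n → ℝ} {x y : Fin n → ℝ} {φ : ℝ → ℝ → ℝ} {Ω : Set (ℝ × ℝ)}
  {c : ℝ → ℝ} {k : (Fin n → ℝ) → ℝ}

lemma beta_mul_beta (x z w : Fin n → ℝ) :
    beta b x z * beta b x w = ∑ i, ∑ j, z i * (b x i * b x j) * w j := by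
  rw [beta, beta, Finset.sum_mul_sum]
  exact Finset.sum_congr rfl fun i _ => Finset.sum_congr rfl fun j _ => by ring

lemma StructureEqs.bilin_eq (h : StructureEqs U φ a b c k) (ha : IsRiemannianOn U a)
    (hx : x ∈ nonzeroSet U b) (z w : Fin n → ℝ) :
    Matrix.toBilin' (Matrix.of (covDeriv a b x)) z w
      = k x * c (normSq a b x)
          * (Matrix.toBilin' (a x) (sharp a b x) (sharp a b x) * Matrix.toBilin' (a x) z w
            - Matrix.toBilin' (a x) (sharp a b x) z * Matrix.toBilin' (a x) (sharp a b x) w)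
        + k x * (Matrix.toBilin' (a x) (sharp a b x) z
            * Matrix.toBilin' (a x) (sharp a b x) w) := by
  rw [ha.bilin_sharp_self hx.1, ha.bilin_sharp hx.1, ha.bilin_sharp hx.1, beta_mul_beta]
  simp only [Matrix.toBilin'_apply, Matrix.of_apply, h.2 x hx, Finset.mul_sum,
    ← Finset.sum_sub_distrib, ← Finset.sum_add_distrib]
  exact Finset.sum_congr rfl fun i _ => Finset.sum_congr rfl fun j _ => by ring

/-- The structure equations force `β` to be closed on all of `U`, zeros included: otherwise `dβ`
would be nonzero on an open set on which `β` vanishes. -/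
lemma StructureEqs.covDeriv_symm (h : StructureEqs U φ a b c k) (ha : IsRiemannianOn U a)
    (hb : ∀ i, ContDiffOn ℝ ∞ (fun x => b x i) U) (hU : IsOpen U) (hx : x ∈ U) (i j : Fin n) :
    covDeriv a b x i j = covDeriv a b x j i := by
  have hsymm : ∀ z ∈ nonzeroSet U b, covDeriv a b z i j = covDeriv a b z j i := by
    intro z hz
    rw [h.2 z hz, h.2 z hz, ha.symm hz.1 i j]
    ring
  by_contra hne
  have hc1 := ((contDiffOn_covDeriv ha hb hU i j).contDiffAt (hU.mem_nhds hx)).continuousAt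
  have hc2 := ((contDiffOn_covDeriv ha hb hU j i).contDiffAt (hU.mem_nhds hx)).continuousAt
  have hev : ∀ᶠ z in nhds x, b z = 0 := by
    filter_upwards [(hc1.sub hc2).eventually_ne (sub_ne_zero.2 hne), hU.mem_nhds hx] with z hz hzU
    by_contra hbz
    exact hz (sub_eq_zero.2 (hsymm z ⟨hzU, hbz⟩))
  have hpd : ∀ i j, pd j (fun z => b z i) x = 0 := by
    intro i j
    have : (fun z => b z i) =ᶠ[nhds x] fun _ => 0 := by
      filter_upwards [hev] with z hz using by rw [hz]; rfl
    simp [pd, this.fderiv_eq]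
  have := covDeriv_sub (b := b) ha hU hx i j
  rw [hpd, hpd, sub_zero] at this
  exact hne (sub_eq_zero.1 this)

/-- The flatness of `F` over a point where `β` does not vanish. -/
lemma StructureEqs.hamelForm_eq_zero (h : StructureEqs U φ a b c k) (ha : IsRiemannianOn U a)
    (hx : x ∈ nonzeroSet U b) (hy : y ≠ 0) (z : Fin n → ℝ) :
    hamelForm (Matrix.toBilin' (a x)) (Matrix.toBilin' (Matrix.of (covDeriv a b x)))
      (sharp a b x) (alpha a x y) (beta b x y / alpha a x y)
      (d1 φ (normSq a b x) (beta b x y / alpha a x y))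
      (d2 (d1 φ) (normSq a b x) (beta b x y / alpha a x y))
      (d2 φ (normSq a b x) (beta b x y / alpha a x y))
      (d2 (d2 φ) (normSq a b x) (beta b x y / alpha a x y)) y z = 0 := by
  have hα := (ha.alpha_pos hx.1 hy).ne'
  refine GenAlphaBeta.hamelForm_eq_zero (c := c (normSq a b x)) (k := k x) hα
    (ha.bilin_symm hx.1) ?_ ?_ (h.bilin_eq ha hx) ?_ z
  · rw [toBilin'_self, ha.alpha_sq hx.1]
  · rw [ha.bilin_sharp hx.1, div_mul_cancel₀ _ hα]
  · rw [ha.bilin_sharp_self hx.1]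
    exact h.1 _ ⟨x, hx, rfl⟩ _ (ha.ratio_sq_le hx.1 hy)

lemma hamelForm_eq_zero_of_parallel {A : (Fin n → ℝ) →ₗ[ℝ] (Fin n → ℝ) →ₗ[ℝ] ℝ}
    {u : Fin n → ℝ} {α s p₁ p₁₂ p₂ p₂₂ : ℝ} {z : Fin n → ℝ}
    (h : ∀ i j, covDeriv a b x i j = 0) :
    hamelForm A (Matrix.toBilin' (Matrix.of (covDeriv a b x))) u α s p₁ p₁₂ p₂ p₂₂ y z = 0 := by
  have h0 : Matrix.of (covDeriv a b x) = 0 := by ext i j; exact h i j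
  simp [hamelForm, h0]

/-- The flatness of `F` over a zero of a closed one-form. -/
lemma hamelForm_eq_zero_of_closed {A B : (Fin n → ℝ) →ₗ[ℝ] (Fin n → ℝ) →ₗ[ℝ] ℝ}
    {α p₁ p₁₂ p₂ p₂₂ : ℝ} {z : Fin n → ℝ} (h : B z y = B y z) :
    hamelForm A B 0 α 0 p₁ p₁₂ p₂ p₂₂ y z = 0 := by
  simp [hamelForm, h]

/-- The projective factors of `F` and `α` differ by the asserted multiple of `α`. -/
lemma StructureEqs.projFactor_eq (h : StructureEqs U φ a b c k) (ha : IsRiemannianOn U a)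
    (hb : ∀ i, ContDiffOn ℝ ∞ (fun x => b x i) U) (hU : IsOpen U) (hΩ : IsOpen Ω)
    (hφ : ContDiffOn ℝ ∞ (fun p : ℝ × ℝ => φ p.1 p.2) Ω)
    (hdom : ∀ x ∈ U, ∀ s : ℝ, s ^ 2 ≤ normSq a b x → (normSq a b x, s) ∈ Ω)
    (hF : IsFinslerOn U (metric φ a b)) (hα : IsProjectivelyFlatOn U (alpha a))
    (hx : x ∈ nonzeroSet U b) (hy : y ≠ 0) :
    projFactor (metric φ a b) x y
      = projFactor (alpha a) x y + sprayFactor φ a b c k x y := by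
  have hαpos := (ha.alpha_pos hx.1 hy).ne'
  have hFpos := hF.pos x hx.1 y hy
  have e1 := two_mul_bilin_covDeriv_sharp ha hb hU hx.1 y
  have e2 := covDeriv_self_of_flat (b := b) ha hU hα hx.1 hy
  rw [h.bilin_eq ha hx] at e1 e2
  rw [ha.bilin_sharp_self hx.1, ha.bilin_sharp hx.1] at e1 e2
  rw [toBilin'_self, ← ha.alpha_sq hx.1] at e2
  simp only [projFactor, dX_metric ha hb hU hΩ hφ hdom hF hx.1 hy, sprayFactor]
  have hφ0 : φ (normSq a b x) (beta b x y / alpha a x y) ≠ 0 := by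
    intro h0
    simp [metric, h0] at hFpos
  have hβ : beta b x y = beta b x y / alpha a x y * alpha a x y := (div_mul_cancel₀ _ hαpos).symm
  simp only [metric]
  generalize beta b x y / alpha a x y = s at *
  rw [hβ] at e1 e2
  simp only [add_mul, Finset.sum_add_distrib, mul_assoc _ _ (y _)]
  simp only [← Finset.mul_sum]
  rw [← e1, eq_add_of_sub_eq e2.symm]
  field_simp
  ring

end Sufficiency

end GenAlphaBeta

end

open GenAlphaBeta in
theorem theorem1p1 (n : ℕ) (hn : 3 ≤ n)
    (U : Set (Fin n → ℝ)) (hUo : IsOpen U) (hUc : IsConnected U)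
    (a : (Fin n → ℝ) → Matrix (Fin n) (Fin n) ℝ)
    (ha : GenAlphaBeta.IsRiemannianOn U a)
    (b : (Fin n → ℝ) → Fin n → ℝ)
    (hb : ∀ i, ContDiffOn ℝ ∞ (fun x => b x i) U)
    (φ : ℝ → ℝ → ℝ) (Ω : Set (ℝ × ℝ)) (hΩ : IsOpen Ω)
    (hφ : ContDiffOn ℝ ∞ (fun p : ℝ × ℝ => φ p.1 p.2) Ω)
    (hdom : ∀ x ∈ U, ∀ s : ℝ, s ^ 2 ≤ GenAlphaBeta.normSq a b x →
      (GenAlphaBeta.normSq a b x, s) ∈ Ω)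
    (hF : GenAlphaBeta.IsFinslerOn U (GenAlphaBeta.metric φ a b))
    (hnR : ¬ GenAlphaBeta.IsRiemannianFinslerOn U (GenAlphaBeta.metric φ a b))
    (hα : GenAlphaBeta.IsProjectivelyFlatOn U (GenAlphaBeta.alpha a))
    (hφ1 : ∀ x ∈ U, GenAlphaBeta.d1 φ (GenAlphaBeta.normSq a b x) 0 ≠ 0)
    (hφ22 : (∃ x ∈ U, ∃ s : ℝ, s ^ 2 ≤ GenAlphaBeta.normSq a b x ∧
        GenAlphaBeta.d2 (GenAlphaBeta.d2 φ) (GenAlphaBeta.normSq a b x) s ≠ 0) ∨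
      (∃ x ∈ U, ∃ x' ∈ U, GenAlphaBeta.normSq a b x ≠ GenAlphaBeta.normSq a b x')) :
    (GenAlphaBeta.IsProjectivelyFlatOn U (GenAlphaBeta.metric φ a b) ↔
      (GenAlphaBeta.IsParallelOn U a b ∨
        ∃ (c : ℝ → ℝ) (k : (Fin n → ℝ) → ℝ),
          ContDiffOn ℝ ∞ c
            (GenAlphaBeta.normSq a b '' GenAlphaBeta.nonzeroSet U b) ∧
          ContDiffOn ℝ ∞ k (GenAlphaBeta.nonzeroSet U b) ∧
          GenAlphaBeta.StructureEqs U φ a b c k)) ∧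
    (∀ (c : ℝ → ℝ) (k : (Fin n → ℝ) → ℝ),
      GenAlphaBeta.StructureEqs U φ a b c k →
      ∀ x ∈ GenAlphaBeta.nonzeroSet U b, ∀ y : Fin n → ℝ, y ≠ 0 → ∀ i : Fin n,
        GenAlphaBeta.spray (GenAlphaBeta.metric φ a b) x y i
          = GenAlphaBeta.spray (GenAlphaBeta.alpha a) x y i
            + GenAlphaBeta.sprayFactor φ a b c k x y * y i) := by
  refine ⟨⟨fun hflat => ?_, ?_⟩, fun c k h x hx y hy i => ?_⟩
  · have hP : ∀ x ∈ U, FlatAt φ a b x := fun x hx =>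
      hamelFlat_of_flat ha hb hUo hΩ hφ hdom hF hα hflat hx
    by_cases hpar : IsParallelOn U a b
    · exact Or.inl hpar
    by_cases hdeg : ∃ x₀ ∈ nonzeroSet U b, d2 (d2 φ) (normSq a b x₀) 0 = 0
    · obtain ⟨x₀, hx₀, h0⟩ := hdeg
      exact Or.inl
        (isParallelOn_of_degenerate hn ha hb hUo hUc hΩ hφ hdom hφ1 hP hφ22 hx₀ h0)
    push Not at hdeg
    refine Or.inr ⟨_, _, ?_, contDiffOn_covSharp_div ha hb hUo,
      structureEqs_of_nondegenerate hn ha hb hUo hUc hΩ hφ hdom hφ1 hP hdeg hpar⟩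
    refine fun t ht => (contDiffAt_structureC hΩ hφ (T := normSq a b '' nonzeroSet U b)
      ?_ ?_ t ht).contDiffWithinAt
    · rintro _ ⟨x, hx, rfl⟩
      exact hdom x hx.1 0 (by simpa using (ha.normSq_pos hx.1 hx.2).le)
    · rintro _ ⟨x, hx, rfl⟩
      exact hdeg x hx
  · rintro h x hx y hy
    rw [hF.spray_eq_iff hUo hx hy]
    intro l
    rw [hamel_metric ha hb hUo hΩ hφ hdom hF hα hx hy l rfl rfl]
    rcases h with hpar | ⟨c, k, -, -, h⟩
    · exact hamelForm_eq_zero_of_parallel (hpar x hx)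
    by_cases hbx : b x = 0
    · have h1 : sharp a b x = 0 := by simp [sharp, hbx]
      have h2 : beta b x y = 0 := by simp [beta, hbx]
      rw [h1, h2, zero_div]
      refine hamelForm_eq_zero_of_closed ?_
      rw [Matrix.toBilin'_apply, Matrix.toBilin'_apply, Finset.sum_comm]
      refine Finset.sum_congr rfl fun i _ => Finset.sum_congr rfl fun j _ => ?_
      rw [Matrix.of_apply, Matrix.of_apply, h.covDeriv_symm ha hb hUo hx j i]
      ring
    · exact h.hamelForm_eq_zero ha ⟨hx, hbx⟩ hy _
  · have hH : ∀ l, hamel (metric φ a b) x y l = 0 := fun l => by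
      rw [hamel_metric ha hb hUo hΩ hφ hdom hF hα hx.1 hy l rfl rfl]
      exact h.hamelForm_eq_zero ha hx hy _
    rw [(hF.spray_eq_iff hUo hx.1 hy).2 hH i, hα x hx.1 y hy i,
      h.projFactor_eq ha hb hUo hΩ hφ hdom hF hα hx hy, add_mul]
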